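/- Let $N\ge 1$ be an integer and write $\mathrm e(z)=e^{2\pi i z}$. Let $\mathcal C=\{z\in\mathbb C:\ \mathrm{Re}\,z>0\}\cup i\,\mathbb R_{>0}$, and let $\mathbb D_N$ be the set of all $(w,a,\theta)\in\mathbb C\times\mathbb C^N\times\mathbb R^N$ such that $\theta_\ell\notin\mathbb Z$ whenever $a_\ell=0$. For $\delta=(w,a,\theta)\in\mathbb D_N$ put $$\pi(\delta)=w-\sum_{\ell:\ a_\ell\in-\mathcal C}a_\ell ,\qquad F_N(u,\delta)=e^{-uw}\prod_{\ell=1}^N\bigl(1-\mathrm e(\theta_\ell)e^{-ua_\ell}\bigr)^{-1}.$$ For $\Lambda\subseteq\{1,\dots,N\}$, $\sigma\in S_N$ and $\alpha\in\mathbb C^*$ let $T_\Lambda(w,a,\theta)=(w-\sum_{\ell\in\Lambda}a_\ell,\,a',\,\theta')$, where $a',\theta'$ arise from $a,\theta$ by changing the sign of the coordinates with index in $\Lambda$; let $R_\sigma(w,a,\theta)=(w,(a_{\sigma^{-1}(\ell)})_\ell,(\theta_{\sigma^{-1}(\ell)})_\ell)$ and $M_\alpha(w,a,\theta)=(\alpha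 w,\alpha a,\theta)$. Let $\widetilde{\mathcal D}^{\mathbb C^*}_N$ be the set of all $\delta\in\mathbb D_N$ with $\pi(M_\alpha\delta)\in\mathcal C$ for every $\alpha\in\mathbb C^*$. Let $\epsilon:\mathbb D_N\to\mathbb R_{>0}$ be any function such that, for all $\delta=(w,a,\theta)\in\mathbb D_N$ and all $\ell$, the equation $\mathrm e(\theta_\ell)=e^{ua_\ell}$ has no solution $u\in\mathbb C$ with $0<|u|\le\epsilon(\delta)$. Define $$\mathcal L_{N,\epsilon}(s,\delta)=\frac1{\Gamma(s)(\mathrm e(s)-1)}\int_{C(\epsilon(\delta))}F_N(u,\delta)\,u^{s-1}\,du,$$ where $C(r)$ is the Hankel contour coming from $+\infty$ to $r$ with $\arg u=0$, going once counterclockwise around $|u|=r$, and returning to $+\infty$ with $\arg u=2\pi$; removable singularities in $s$ are removed. For $s\in\mathbb C\smallsetminus\{1,\dots,N\}$ put $$\mathcal L_N(s,\delta)=\lim_{\omega\to0^-}\mathcal L_{N,\epsilon}\bigl(s,M_{e^{i\omega}}\delta\bigr)$$ and denote by $\mathcal L_N'$ its derivative with respect to $s$. For a nonzero angle $\psi\in(-\pi,\pi]$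 let $\mathcal P_\psi(\delta)$ be the set of nonzero poles $u_0$ of $u\mapsto F_N(u,\delta)$ whose principal argument lies in $[0,\psi)$ if $\psi>0$, respectively in $[\psi,0)$ if $\psi<0$. For $\mathrm{Re}(s)<1$ put $$\rho_N^\psi(s,\delta)=\mathrm{sgn}(-\psi)\,2\pi i\lim_{R\to\infty}\ \sum_{u_0\in\mathcal P_\psi(\delta),\ |u_0|<R}\mathrm{Res}_{u=u_0}\bigl(F_N(u,\delta)\,u^{s-1}\bigr)$$ with the principal branch of $u^{s-1}$, and $\rho_N^0=0$. Here $R\to\infty$ through radii for which the circle $|u|=R$ stays uniformly away from the nonzero poles of $F_N(\cdot,\delta)$: for each constant $c>0$ the limit is taken over those $R$ for which the circle has distance at least $c$ from these poles; such $R$ are unbounded if $c$ is small enough, and the limit does not depend on $c$. Let $\Lambda\subseteq\{1,\dots,N\}$, $\sigma\in S_N$, $\alpha\in\mathbb C^*$, $g=T_\Lambda R_\sigma M_\alpha$, $\psi=\arg(\alpha)\in(-\pi,\pi]$, $\log\alpha=\log|\alpha|+i\psi$, and $$J_g(s,\theta)=(-1)^{|\Lambda|}\,\mathrm e\Bigl(\sum_{\ell\in\sigma^{-1}[\Lambda]}\theta_\ell\Bigr)\,e^{-s\log\alpha}.$$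 Then for all integers $k\ge0$ and all $\delta=(w,a,\theta)\in\widetilde{\mathcal D}^{\mathbb C^*}_N$ we have $g\delta\in\widetilde{\mathcal D}^{\mathbb C^*}_N$; the functions $s\mapsto\mathcal L_N(s,\delta)$ and $s\mapsto\mathcal L_N(s,g\delta)$ are well-defined near $s=-k$ and differentiable at $s=-k$; the limit defining $\rho_N^\psi(-k,\delta)$ exists; and $$\mathcal L_N(-k,g\delta)=J_g(-k,\theta)\,\mathcal L_N(-k,\delta),$$ $$\mathcal L_N'(-k,g\delta)=J_g(-k,\theta)\Bigl[\mathcal L_N'(-k,\delta)-\log(\alpha)\,\mathcal L_N(-k,\delta)+(-1)^k\,k!\;\rho_N^\psi(-k,\delta)\Bigr].$$ -/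

import Mathlib

open Filter Topology MeasureTheory

noncomputable section

namespace Barnes

/-- The parameter space `ℂ × ℂ^N × ℝ^N`, with points `δ = (w, a, θ)`. -/
abbrev Param (N : ℕ) : Type := ℂ × (Fin N → ℂ) × (Fin N → ℝ)

/-- `e(z) = exp(2πiz)`. -/
def e (z : ℂ) : ℂ := Complex.exp (2 * Real.pi * Complex.I * z)

/-- The convex cone of all `z` with `Re z > 0` or `z ∈ i·ℝ_{>0}`. -/
def cone : Set ℂ := {z | 0 < z.re ∨ (z.re = 0 ∧ 0 < z.im)}

/-- The set `𝔻_N` of all `(w, a, θ)` such that `θ_ℓ ∉ ℤ` whenever `a_ℓ = 0`. -/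
def bigD (N : ℕ) : Set (Param N) :=
  {δ | ∀ l, δ.2.1 l = 0 → ∀ m : ℤ, δ.2.2 l ≠ m}

open Classical in
/-- `π(w, a, θ) = w - ∑ a_ℓ`, the sum over all `ℓ` with `a_ℓ ∈ -cone`. -/
def proj {N : ℕ} (δ : Param N) : ℂ :=
  δ.1 - ∑ l with -(δ.2.1 l) ∈ cone, δ.2.1 l

/-- `T_Λ(w, a, θ) = (w - ∑_{ℓ ∈ Λ} a_ℓ, a d(Λ), θ d(Λ))`, where the diagonal matrix `d(Λ)` changes
the sign of the coordinates in `Λ`. -/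
def T {N : ℕ} (Λ : Finset (Fin N)) (δ : Param N) : Param N :=
  (δ.1 - ∑ l ∈ Λ, δ.2.1 l,
    fun l => if l ∈ Λ then -(δ.2.1 l) else δ.2.1 l,
    fun l => if l ∈ Λ then -(δ.2.2 l) else δ.2.2 l)

/-- `R_σ(w, a, θ) = (w, a r(σ), θ r(σ))`, where the `ℓ`-th column of the permutation matrix `r(σ)`
is the `σ⁻¹(ℓ)`-th column of the identity matrix, so that `(a r(σ))_ℓ = a_{σ⁻¹(ℓ)}`. -/
def R {N : ℕ} (σ : Equiv.Perm (Fin N)) (δ : Param N) : Param N :=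
  (δ.1, fun l => δ.2.1 (σ⁻¹ l), fun l => δ.2.2 (σ⁻¹ l))

/-- `M_α(w, a, θ) = (αw, αa, θ)`. -/
def M {N : ℕ} (α : ℂ) (δ : Param N) : Param N :=
  (α * δ.1, fun l => α * δ.2.1 l, δ.2.2)

/-- The transformation `g = T_Λ R_σ M_α`. -/
def G {N : ℕ} (Λ : Finset (Fin N)) (σ : Equiv.Perm (Fin N)) (α : ℂ) (δ : Param N) : Param N :=
  T Λ (R σ (M α δ))

/-- The `ℂ^*`-stable domain: all `δ ∈ 𝔻_N` with `π(M_α δ) ∈ cone` for every `α ∈ ℂ^*`. -/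
def starD (N : ℕ) : Set (Param N) :=
  {δ | δ ∈ bigD N ∧ ∀ α : ℂ, α ≠ 0 → proj (M α δ) ∈ cone}

/-- `J_g(s, θ) = (-1)^|Λ| e(∑_{ℓ ∈ σ⁻¹[Λ]} θ_ℓ) α^{-s}` for `g = T_Λ R_σ M_α`, with the principal
branch of the logarithm. -/
def J {N : ℕ} (Λ : Finset (Fin N)) (σ : Equiv.Perm (Fin N)) (α : ℂ) (s : ℂ) (θ : Fin N → ℝ) : ℂ :=
  (-1) ^ Λ.card * e ((∑ l ∈ Λ.image (fun j => σ⁻¹ j), θ l : ℝ) : ℂ) * α ^ (-s)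

/-- The test function `F_N(u, w, a, θ) = e^{-uw} ∏_ℓ (1 - e(θ_ℓ) e^{-u a_ℓ})⁻¹`. -/
def F {N : ℕ} (u : ℂ) (δ : Param N) : ℂ :=
  Complex.exp (-(u * δ.1)) * ∏ l, (1 - e (δ.2.2 l) * Complex.exp (-(u * δ.2.1 l)))⁻¹

/-- The set `ℰ` of admissible radius functions: `ε > 0` on `𝔻_N` and no equation
`e(θ_ℓ) = e^{u a_ℓ}` has a solution `u` with `0 < |u| ≤ ε(w, a, θ)`. -/
def admissible (N : ℕ) : Set (Param N → ℝ) :=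
  {ε | ∀ δ ∈ bigD N, 0 < ε δ ∧ ∀ (l : Fin N) (u : ℂ), 0 < ‖u‖ → ‖u‖ ≤ ε δ →
    e (δ.2.2 l) ≠ Complex.exp (u * δ.2.1 l)}

/-- `u^{s-1} = e^{(s-1)(log r + it)}` at the point `u = r e^{it}`, its argument taken to be `t`. -/
def branchPow (r t : ℝ) (s : ℂ) : ℂ :=
  Complex.exp ((s - 1) * (Real.log r + Complex.I * t))

/-- The integral of `F_N(u, δ) u^{s-1}` along the Hankel contour: from `+∞` to `r` with argument
`0`, once counterclockwise around the circle `|u| = r`, and from `r` to `+∞` with argument `2π`. -/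
def hankel {N : ℕ} (r : ℝ) (s : ℂ) (δ : Param N) : ℂ :=
  -(∫ x in Set.Ioi r, F (x : ℂ) δ * branchPow x 0 s)
    + (∫ t in (0 : ℝ)..(2 * Real.pi),
        F (r * Complex.exp (Complex.I * t)) δ * branchPow r t s
          * (Complex.I * r * Complex.exp (Complex.I * t)))
    + ∫ x in Set.Ioi r, F (x : ℂ) δ * branchPow x (2 * Real.pi) s

/-- The quotient of the Hankel integral by `Γ(s)(e(s) - 1)`; it is meaningful for `s ∉ ℤ`. -/
def Lraw {N : ℕ} (ε : Param N → ℝ) (s : ℂ) (δ : Param N) : ℂ :=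
  hankel (ε δ) s δ / (Complex.Gamma s * (e s - 1))

/-- `ℒ_{N,ε}(s, δ)`: the quotient `Lraw` with its removable singularities in `s` removed. (At
`s = -k` the product `Γ(s)(e(s) - 1)` has the shape `∞ · 0`.) -/
def Leps {N : ℕ} (ε : Param N → ℝ) (s : ℂ) (δ : Param N) : ℂ :=
  limUnder (𝓝[≠] s) fun z => Lraw ε z δ

/-- `ℒ_N(s, δ) = lim_{ω → 0⁻} ℒ_{N,ε}(s, M_{e^{iω}} δ)`. -/
def L {N : ℕ} (ε : Param N → ℝ) (s : ℂ) (δ : Param N) : ℂ :=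
  limUnder (𝓝[<] (0 : ℝ)) fun ω => Leps ε s (M (Complex.exp (Complex.I * ω)) δ)

/-- All integrals and limits that enter the definition of `ℒ_N(s, δ)` exist. -/
def LDefined {N : ℕ} (ε : Param N → ℝ) (s : ℂ) (δ : Param N) : Prop :=
  (∀ᶠ ω : ℝ in 𝓝[<] 0,
    (∀ z : ℂ, IntegrableOn
      (fun x : ℝ => F (x : ℂ) (M (Complex.exp (Complex.I * ω)) δ) * branchPow x 0 z)
      (Set.Ioi (ε (M (Complex.exp (Complex.I * ω)) δ)))) ∧
    ∃ c : ℂ, Tendsto (fun z => Lraw ε z (M (Complex.exp (Complex.I * ω)) δ)) (𝓝[≠] s) (𝓝 c)) ∧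
  ∃ c : ℂ, Tendsto (fun ω : ℝ => Leps ε s (M (Complex.exp (Complex.I * ω)) δ)) (𝓝[<] 0) (𝓝 c)

/-- The nonzero poles of `u ↦ F_N(u, δ)`. The numerator has no zeros, hence for `δ ∈ 𝔻_N` the poles
are the zeros of the factors of the denominator. -/
def poles {N : ℕ} (δ : Param N) : Set ℂ :=
  {u | u ≠ 0 ∧ ∃ l, 1 - e (δ.2.2 l) * Complex.exp (-(u * δ.2.1 l)) = 0}

/-- The nonzero poles with principal argument in `[0, ψ)` (for `ψ > 0`) or in `[ψ, 0)`
(for `ψ < 0`). -/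
def sectorPoles {N : ℕ} (ψ : ℝ) (δ : Param N) : Set ℂ :=
  {u | u ∈ poles δ ∧ ((0 < ψ ∧ 0 ≤ u.arg ∧ u.arg < ψ) ∨ (ψ < 0 ∧ ψ ≤ u.arg ∧ u.arg < 0))}

/-- The residue of `f` at an isolated singularity `u₀`: the common value of
`(2πi)⁻¹ ∮ f(u) du` over all sufficiently small circles around `u₀`. -/
def residue (f : ℂ → ℂ) (u₀ : ℂ) : ℂ :=
  limUnder (𝓝[>] (0 : ℝ)) fun r => (2 * Real.pi * Complex.I)⁻¹ * ∮ u in C(u₀, r), f u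

/-- The sum of the residues of `F_N(u, δ) u^{s-1}` (principal branch) at the poles in the sector
that lie in the disc `|u| < r`. -/
def residueSum {N : ℕ} (ψ : ℝ) (s : ℂ) (δ : Param N) (r : ℝ) : ℂ :=
  ∑ᶠ u₀ ∈ {u | u ∈ sectorPoles ψ δ ∧ ‖u‖ < r}, residue (fun u => F u δ * u ^ (s - 1)) u₀

/-- `r → ∞` through radii for which the circle `|u| = r` keeps a distance of at least some
constant `c > 0` from the nonzero poles of `F_N(u, δ)`. A function tends to `ℓ` along this filter
if and only if it does so for each constant `c > 0`. -/
def farRadii {N : ℕ} (δ : Param N) : Filter ℝ :=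
  ⨆ c ∈ Set.Ioi (0 : ℝ), atTop ⊓ 𝓟 {r | ∀ u ∈ poles δ, c ≤ |‖u‖ - r|}

/-- `ρ_N^ψ(s, δ) = sgn(-ψ) 2πi lim_{r → ∞} ∑ Res(F_N(u, δ) u^{s-1})`, for `Re s < 1`. -/
def rho {N : ℕ} (ψ : ℝ) (s : ℂ) (δ : Param N) : ℂ :=
  (Real.sign (-ψ) : ℂ) * (2 * Real.pi * Complex.I) * limUnder (farRadii δ) (residueSum ψ s δ)

/-- The limit that defines `ρ_N^ψ(s, δ)` exists and is not taken along a trivial filter. -/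
def RhoDefined {N : ℕ} (ψ : ℝ) (s : ℂ) (δ : Param N) : Prop :=
  (farRadii δ).NeBot ∧ ∃ c : ℂ, Tendsto (residueSum ψ s δ) (farRadii δ) (𝓝 c)

end Barnes

end

namespace Barnes

/-! ### The transformations `M`, `R`, `T` -/

/-! Replacing `a` by `-a` multiplies a factor of `F` by an exponential, which the shift of `w`
absorbs. Hence `F(u, gδ)` is a constant times `F(αu, δ)` (`F_G`). Substituting `v = αu` in the
Hankel integral of `gδ` therefore gives `J_g(s, θ)` times the Hankel integral of `δ` over a contour
that leaves from infinity along argument `ψ = arg α` instead of `0` (`hankel_eq_tiltedHankel`). The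
limit `ω → 0⁻` tilts every contour slightly clockwise, off the directions that carry poles or lack
decay. The contours for `δ` and `gδ` can then be fixed at arguments `-η` and `ψ - η` with small `η >
0` (`L_G_eval`).

One turn around the origin multiplies `u^{s-1} du` by `e(s)`. So the two tilted integrals differ by
`(e(s) - 1) K(s)`, where `K` is entire: the ray at `ψ - η`, plus the inner arc, minus the ray at
`-η` (`tiltedHankel_sub`). At `s = -k` the factor `e(s) - 1` vanishes with derivative `2πi`. The
values thus agree up to `J_g`, while the derivatives acquire the extra term `(-1)^k k! K(-k)`,
because `1/(Γ(s)(e(s) - 1))` extends to `-k` with value `(-1)^k k!/(2πi)` (`gammaFactor_neg_nat`).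
Differentiating `α^{-s}` produces the term with `log α`.

It remains to see that `K(s)` is `ρ^ψ(s)` for `Re s < 1`. This is the residue theorem in a growing
sector, provided that the outer arcs tend to `0` (`tendsto_residue_sum`, `tendsto_residueSum`). Here
the stability of the domain enters: it bounds the exponential decay rate of `F` near each direction
`t₀` below by `κ|t - t₀|` (`exists_mul_abs_le_decayRate`). So bad directions are isolated, and an
argument as in Jordan's lemma bounds the outer arc by a multiple of `R^{Re s - 1}`
(`tendsto_arc_farRadii`). -/

lemma e_ne_zero (z : ℂ) : e z ≠ 0 := Complex.exp_ne_zero _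

lemma e_neg (z : ℂ) : e (-z) = (e z)⁻¹ := by
  rw [e, e, ← Complex.exp_neg]; ring_nf

lemma e_sum {ι : Type*} (S : Finset ι) (f : ι → ℂ) : e (∑ i ∈ S, f i) = ∏ i ∈ S, e (f i) := by
  simp only [e, Finset.mul_sum, Complex.exp_sum]

lemma F_M {N : ℕ} (β u : ℂ) (δ : Param N) : F u (M β δ) = F (β * u) δ := by
  simp only [F, M]
  congr 2
  · ring_nf
  · ext l; ring_nf

lemma F_R {N : ℕ} (σ : Equiv.Perm (Fin N)) (u : ℂ) (δ : Param N) : F u (R σ δ) = F u δ := by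
  simp only [F, R]
  congr 1
  exact Equiv.prod_comp σ⁻¹ fun l => (1 - e (δ.2.2 l) * Complex.exp (-(u * δ.2.1 l)))⁻¹

/-- At `y = 1` both sides are `0` by the convention `0⁻¹ = 0`, so the transformation laws of `F`
need no exception at poles. -/
lemma inv_one_sub_inv (y : ℂ) (hy : y ≠ 0) : (1 - y⁻¹)⁻¹ = -y * (1 - y)⁻¹ := by
  rcases eq_or_ne y 1 with rfl | h
  · simp
  · have h1 : 1 - y ≠ 0 := sub_ne_zero.2 h.symm
    have h2 : 1 - y⁻¹ ≠ 0 := sub_ne_zero.2 (by simpa [eq_comm] using h)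
    rw [inv_eq_iff_eq_inv, mul_inv, inv_inv]
    field_simp
    ring

/-- Each reflected factor contributes `-e(θ_ℓ) e^{-u a_ℓ}`. The exponentials in `u` cancel against
the shift of `w`, and only a constant remains. -/
lemma F_T {N : ℕ} (Λ : Finset (Fin N)) (u : ℂ) (δ : Param N) :
    F u (T Λ δ) = (-1) ^ Λ.card * e ((∑ l ∈ Λ, δ.2.2 l : ℝ) : ℂ) * F u δ := by
  have key : ∀ l, (1 - e ((if l ∈ Λ then -(δ.2.2 l) else δ.2.2 l : ℝ) : ℂ) *
      Complex.exp (-(u * (if l ∈ Λ then -(δ.2.1 l) else δ.2.1 l))))⁻¹ =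
      (if l ∈ Λ then -(e (δ.2.2 l) * Complex.exp (-(u * δ.2.1 l))) else 1) *
        (1 - e (δ.2.2 l) * Complex.exp (-(u * δ.2.1 l)))⁻¹ := by
    intro l
    by_cases h : l ∈ Λ
    · simp only [h, if_true]
      rw [← inv_one_sub_inv _ (mul_ne_zero (e_ne_zero _) (Complex.exp_ne_zero _)), mul_inv,
        ← e_neg, ← Complex.exp_neg]
      push_cast
      ring_nf
    · simp [h]
  simp only [F, T, key]
  rw [Finset.prod_mul_distrib, Finset.prod_ite_mem, Finset.univ_inter, Finset.prod_neg,
    Finset.prod_mul_distrib, ← Complex.exp_sum]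
  push_cast
  rw [e_sum]
  have : Complex.exp (-(u * (δ.1 - ∑ l ∈ Λ, δ.2.1 l))) * Complex.exp (∑ l ∈ Λ, -(u * δ.2.1 l)) =
      Complex.exp (-(u * δ.1)) := by
    rw [← Complex.exp_add, Finset.sum_neg_distrib, ← Finset.mul_sum]; ring_nf
  rw [← this]; ring

lemma F_G {N : ℕ} (Λ : Finset (Fin N)) (σ : Equiv.Perm (Fin N)) (α u : ℂ) (δ : Param N) :
    F u (G Λ σ α δ) = (-1) ^ Λ.card * e ((∑ l ∈ Λ.image (fun j => σ⁻¹ j), δ.2.2 l : ℝ) : ℂ) *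
      F (α * u) δ := by
  rw [G, F_T, F_R, F_M, Finset.sum_image fun x _ y _ h => σ⁻¹.injective h]
  rfl

lemma M_M {N : ℕ} (β α : ℂ) (δ : Param N) : M β (M α δ) = M (β * α) δ := by
  simp only [M, mul_assoc]

lemma M_R {N : ℕ} (β : ℂ) (σ : Equiv.Perm (Fin N)) (δ : Param N) :
    M β (R σ δ) = R σ (M β δ) := rfl

lemma M_T {N : ℕ} (β : ℂ) (Λ : Finset (Fin N)) (δ : Param N) :
    M β (T Λ δ) = T Λ (M β δ) := by
  simp only [M, T, mul_sub, Finset.mul_sum, mul_ite, mul_neg]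

lemma M_G {N : ℕ} (β : ℂ) (Λ : Finset (Fin N)) (σ : Equiv.Perm (Fin N)) (α : ℂ) (δ : Param N) :
    M β (G Λ σ α δ) = G Λ σ (β * α) δ := by
  rw [G, M_T, M_R, M_M, G]

lemma G_one {N : ℕ} (δ : Param N) : G ∅ 1 1 δ = δ := by
  simp [G, T, R, M]

lemma neg_mem_cone {z : ℂ} (hz : z ≠ 0) : -z ∈ cone ↔ z ∉ cone := by
  have hz' : z.re ≠ 0 ∨ z.im ≠ 0 := by
    by_contra! h
    exact hz (Complex.ext h.1 h.2)
  simp only [cone, Set.mem_ofPred_eq, Complex.neg_re, Complex.neg_im]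
  grind

open Classical in
lemma proj_eq {N : ℕ} (δ : Param N) :
    proj δ = δ.1 - ∑ l, if -(δ.2.1 l) ∈ cone then δ.2.1 l else 0 := by
  rw [proj, Finset.sum_filter]

lemma proj_R {N : ℕ} (σ : Equiv.Perm (Fin N)) (δ : Param N) : proj (R σ δ) = proj δ := by
  classical
  rw [proj_eq, proj_eq]
  congr 1
  exact Equiv.sum_comp σ⁻¹ fun l => if -(δ.2.1 l) ∈ cone then δ.2.1 l else 0

/-- For `z ≠ 0` exactly one of `z`, `-z` lies in `cone`. A sign change thus moves `a_ℓ` into or out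
of the sum, which the shift of `w` compensates. -/
lemma proj_T {N : ℕ} (Λ : Finset (Fin N)) (δ : Param N) : proj (T Λ δ) = proj δ := by
  classical
  rw [proj_eq, proj_eq]
  simp only [T]
  rw [sub_sub, show ∑ l ∈ Λ, δ.2.1 l = ∑ l, if l ∈ Λ then δ.2.1 l else 0 by simp,
    ← Finset.sum_add_distrib]
  congr 1
  refine Finset.sum_congr rfl fun l _ => ?_
  rcases eq_or_ne (δ.2.1 l) 0 with h0 | h0
  · simp [h0]
  · have := neg_mem_cone h0
    by_cases hl : l ∈ Λ <;> by_cases hc : δ.2.1 l ∈ cone <;> simp_all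

lemma G_mem_bigD {N : ℕ} (Λ : Finset (Fin N)) (σ : Equiv.Perm (Fin N)) {α : ℂ} (hα : α ≠ 0)
    {δ : Param N} (hδ : δ ∈ bigD N) : G Λ σ α δ ∈ bigD N := by
  intro l hl m hm
  by_cases h : l ∈ Λ
  · simp only [G, T, R, M, h, if_true, neg_eq_zero, mul_eq_zero, hα, false_or] at hl hm
    exact hδ _ hl (-m) (by push_cast; linarith)
  · simp only [G, T, R, M, h, if_false, mul_eq_zero, hα, false_or] at hl hm
    exact hδ _ hl m hm

lemma G_mem_starD {N : ℕ} (Λ : Finset (Fin N)) (σ : Equiv.Perm (Fin N)) {α : ℂ} (hα : α ≠ 0)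
    {δ : Param N} (hδ : δ ∈ starD N) : G Λ σ α δ ∈ starD N := by
  refine ⟨G_mem_bigD Λ σ hα hδ.1, fun β hβ => ?_⟩
  rw [M_G, G, proj_T, proj_R]
  exact hδ.2 _ (mul_ne_zero hβ hα)

lemma one_sub_e_mul_exp_eq_zero {θ : ℝ} {v : ℂ} :
    1 - e θ * Complex.exp (-v) = 0 ↔ e θ = Complex.exp v := by
  rw [Complex.exp_neg, sub_eq_zero, eq_comm, mul_inv_eq_one₀ (Complex.exp_ne_zero _)]

lemma e_eq_exp_iff {θ : ℝ} {v : ℂ} :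
    e θ = Complex.exp v ↔ ∃ n : ℤ, v = 2 * Real.pi * Complex.I * (θ + n) := by
  rw [e, eq_comm, Complex.exp_eq_exp_iff_exists_int]
  refine exists_congr fun n => ?_
  rw [mul_add]
  ring_nf

lemma mem_poles {N : ℕ} {δ : Param N} {u : ℂ} :
    u ∈ poles δ ↔ u ≠ 0 ∧ ∃ l, e (δ.2.2 l) = Complex.exp (u * δ.2.1 l) := by
  simp only [poles, Set.mem_ofPred_eq, one_sub_e_mul_exp_eq_zero]

lemma mem_poles_G {N : ℕ} (Λ : Finset (Fin N)) (σ : Equiv.Perm (Fin N)) {α : ℂ} (hα : α ≠ 0)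
    {δ : Param N} {u : ℂ} : u ∈ poles (G Λ σ α δ) ↔ α * u ∈ poles δ := by
  rw [mem_poles, mem_poles]
  refine and_congr (by simp [hα]) ?_
  have : ∀ l, e ((G Λ σ α δ).2.2 l) = Complex.exp (u * (G Λ σ α δ).2.1 l) ↔
      e (δ.2.2 (σ⁻¹ l)) = Complex.exp (α * u * δ.2.1 (σ⁻¹ l)) := by
    intro l
    by_cases h : l ∈ Λ
    · simp only [G, T, R, M, h, if_true]
      push_cast
      rw [e_neg, mul_neg, Complex.exp_neg, inv_inj]
      ring_nf
    · simp only [G, T, R, M, h, if_false]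
      ring_nf
  simp only [this]
  exact (Equiv.exists_congr_left (σ⁻¹ : Equiv.Perm (Fin N))).trans (by simp)

/-! ### The decay rate of `F_N` along rays -/

/-- The exponential rate at which `F_N(r e^{it}, δ)` decays as `r → ∞`. -/
noncomputable def decayRate {N : ℕ} (δ : Param N) (t : ℝ) : ℝ :=
  (Complex.exp (Complex.I * t) * δ.1).re + ∑ l, max 0 (-(Complex.exp (Complex.I * t) * δ.2.1 l).re)

open Classical in
lemma proj_M {N : ℕ} (β : ℂ) (δ : Param N) :
    proj (M β δ) = β * δ.1 - ∑ l, if -(β * δ.2.1 l) ∈ cone then β * δ.2.1 l else 0 :=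
  proj_eq _

/-- Points of the imaginary axis do not contribute to the real part, so it is irrelevant which half
of the axis belongs to `cone`. -/
lemma decayRate_eq_re_proj {N : ℕ} (δ : Param N) (t : ℝ) :
    decayRate δ t = (proj (M (Complex.exp (Complex.I * t)) δ)).re := by
  classical
  rw [proj_M, decayRate, Complex.sub_re, Complex.re_sum, sub_eq_add_neg, ← Finset.sum_neg_distrib]
  congr 1
  refine Finset.sum_congr rfl fun l _ => ?_
  set z := Complex.exp (Complex.I * t) * δ.2.1 l
  split_ifs with h
  · rw [max_eq_right]
    rcases h with h | h
    · exact h.le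
    · exact h.1.ge
  · rw [max_eq_left]
    · simp
    · by_contra! h'
      exact h (Or.inl h')

lemma exp_mul_re (τ : ℝ) (P : ℂ) :
    (Complex.exp (Complex.I * τ) * P).re = Real.cos τ * P.re - Real.sin τ * P.im := by
  rw [mul_comm Complex.I, Complex.exp_mul_I]
  simp [← Complex.ofReal_cos, ← Complex.ofReal_sin]

lemma exp_mul_im (τ : ℝ) (P : ℂ) :
    (Complex.exp (Complex.I * τ) * P).im = Real.cos τ * P.im + Real.sin τ * P.re := by
  rw [mul_comm Complex.I, Complex.exp_mul_I]
  simp [← Complex.ofReal_cos, ← Complex.ofReal_sin]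

lemma exp_I_mul_eq (t t₀ : ℝ) (a : ℂ) : Complex.exp (Complex.I * t) * a =
    Complex.exp (Complex.I * (t - t₀ : ℝ)) * (Complex.exp (Complex.I * t₀) * a) := by
  rw [← mul_assoc, ← Complex.exp_add]; push_cast; ring_nf

lemma continuous_exp_mul_re (t₀ : ℝ) (b : ℂ) :
    Continuous fun t : ℝ => (Complex.exp (Complex.I * (t - t₀ : ℝ)) * b).re := by
  fun_prop

lemma eventually_mem_cone_of_re_ne {b : ℂ} (hb : b.re ≠ 0) (t₀ : ℝ) :
    ∀ᶠ t : ℝ in 𝓝 t₀, (Complex.exp (Complex.I * (t - t₀ : ℝ)) * b ∈ cone ↔ b ∈ cone) := by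
  have hc := (continuous_exp_mul_re t₀ b).tendsto t₀
  simp only [sub_self, Complex.ofReal_zero, mul_zero, Complex.exp_zero, one_mul] at hc
  rcases hb.lt_or_gt with h | h
  · filter_upwards [hc.eventually_lt_const h] with t ht
    simp only [cone, Set.mem_ofPred_eq]
    exact ⟨fun h' => by rcases h' with h' | ⟨h', -⟩ <;> linarith,
      fun h' => by rcases h' with h' | ⟨h', -⟩ <;> linarith⟩
  · filter_upwards [hc.eventually_const_lt h] with t ht
    simp only [cone, Set.mem_ofPred_eq]
    exact ⟨fun _ => Or.inl h, fun _ => Or.inl ht⟩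

/-- Clockwise rotation carries the upper imaginary half-axis, which lies in `cone`, into the right
half-plane and the lower one into the left half-plane. -/
lemma eventually_mem_cone_left (b : ℂ) (t₀ : ℝ) :
    ∀ᶠ t : ℝ in 𝓝[<] t₀, (Complex.exp (Complex.I * (t - t₀ : ℝ)) * b ∈ cone ↔ b ∈ cone) := by
  by_cases hb : b.re = 0
  · filter_upwards [Ioo_mem_nhdsLT (show t₀ - 1 < t₀ by linarith)] with t ht
    have hs : Real.sin (t - t₀) < 0 :=
      Real.sin_neg_of_neg_of_neg_pi_lt (by linarith [ht.2]) (by linarith [ht.1, Real.pi_gt_three])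
    have hcos : 0 < Real.cos (t - t₀) := Real.cos_pos_of_mem_Ioo
      ⟨by linarith [ht.1, Real.pi_gt_three], by linarith [ht.2, Real.pi_gt_three]⟩
    simp only [cone, Set.mem_ofPred_eq, exp_mul_re, exp_mul_im, hb, mul_zero, zero_sub, add_zero,
      lt_irrefl, false_or, true_and]
    constructor
    · rintro (h | ⟨-, h⟩)
      · nlinarith
      · exact pos_of_mul_pos_right h hcos.le
    · intro h
      left
      nlinarith
  · exact (eventually_mem_cone_of_re_ne hb t₀).filter_mono nhdsWithin_le_nhds

/-- Counterclockwise rotation exchanges the roles of the two imaginary half-axes. Membership may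
jump at `t₀`, but it is constant just after it. -/
lemma eventually_mem_cone_right (b : ℂ) (t₀ : ℝ) :
    ∃ p : Prop, ∀ᶠ t : ℝ in 𝓝[>] t₀, (Complex.exp (Complex.I * (t - t₀ : ℝ)) * b ∈ cone ↔ p) := by
  by_cases hb : b.re = 0
  · refine ⟨b.im < 0, ?_⟩
    filter_upwards [Ioo_mem_nhdsGT (show t₀ < t₀ + 1 by linarith)] with t ht
    have hs : 0 < Real.sin (t - t₀) :=
      Real.sin_pos_of_pos_of_lt_pi (by linarith [ht.1]) (by linarith [ht.2, Real.pi_gt_three])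
    simp only [cone, Set.mem_ofPred_eq, exp_mul_re, exp_mul_im, hb, mul_zero, zero_sub, add_zero]
    constructor
    · rintro (h | ⟨h, h'⟩)
      · by_contra! h'
        nlinarith
      · have : b.im = 0 := by
          rcases mul_eq_zero.1 (neg_eq_zero.1 h) with h | h
          · exact absurd h hs.ne'
          · exact h
        simp [this] at h'
    · intro h
      left
      nlinarith
  · exact ⟨_, (eventually_mem_cone_of_re_ne hb t₀).filter_mono nhdsWithin_le_nhds⟩

lemma proj_M_left {N : ℕ} (δ : Param N) (t₀ : ℝ) :
    ∀ᶠ t : ℝ in 𝓝[<] t₀, proj (M (Complex.exp (Complex.I * t)) δ) =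
      Complex.exp (Complex.I * (t - t₀ : ℝ)) * proj (M (Complex.exp (Complex.I * t₀)) δ) := by
  classical
  filter_upwards [eventually_all.2 fun l =>
    eventually_mem_cone_left (-(Complex.exp (Complex.I * t₀) * δ.2.1 l)) t₀] with t ht
  rw [proj_M, proj_M, mul_sub, Finset.mul_sum, ← exp_I_mul_eq]
  congr 1
  refine Finset.sum_congr rfl fun l _ => ?_
  have := ht l
  rw [mul_neg, ← exp_I_mul_eq] at this
  simp only [this, mul_ite, mul_zero]
  rw [← exp_I_mul_eq]

/-- The set of indices in the sum is constant just after `t₀`, so the projection merely rotates.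
Unlike on the left, `P` need not be the projection at `t₀` itself. -/
lemma proj_M_right {N : ℕ} (δ : Param N) (t₀ : ℝ) :
    ∃ P : ℂ, ∀ᶠ t : ℝ in 𝓝[>] t₀, proj (M (Complex.exp (Complex.I * t)) δ) =
      Complex.exp (Complex.I * (t - t₀ : ℝ)) * P := by
  classical
  choose p hp using fun l =>
    eventually_mem_cone_right (-(Complex.exp (Complex.I * t₀) * δ.2.1 l)) t₀
  refine ⟨Complex.exp (Complex.I * t₀) * δ.1 -
    ∑ l, if p l then Complex.exp (Complex.I * t₀) * δ.2.1 l else 0, ?_⟩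
  filter_upwards [eventually_all.2 hp] with t ht
  rw [proj_M, mul_sub, Finset.mul_sum, ← exp_I_mul_eq]
  congr 1
  refine Finset.sum_congr rfl fun l _ => ?_
  have := ht l
  rw [mul_neg, ← exp_I_mul_eq] at this
  simp only [this, mul_ite, mul_zero]
  rw [← exp_I_mul_eq]

lemma abs_le_re_of_re_pos {P : ℂ} (hP : 0 < P.re) (t₀ : ℝ) :
    ∀ᶠ t : ℝ in 𝓝 t₀, |t - t₀| ≤ (Complex.exp (Complex.I * (t - t₀ : ℝ)) * P).re := by
  have h1 : Tendsto (fun t : ℝ => (Complex.exp (Complex.I * (t - t₀ : ℝ)) * P).re - |t - t₀|)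
      (𝓝 t₀) (𝓝 (P.re)) := by
    have : Continuous fun t : ℝ =>
        (Complex.exp (Complex.I * (t - t₀ : ℝ)) * P).re - |t - t₀| := by fun_prop
    simpa using this.tendsto t₀
  filter_upwards [h1.eventually_const_lt hP] with t ht
  linarith

lemma continuous_decayRate {N : ℕ} (δ : Param N) : Continuous (decayRate δ) := by
  unfold decayRate
  fun_prop

lemma decayRate_nonneg {N : ℕ} {δ : Param N} (hδ : δ ∈ starD N) (t : ℝ) : 0 ≤ decayRate δ t := by
  rw [decayRate_eq_re_proj]
  rcases hδ.2 _ (Complex.exp_ne_zero (Complex.I * t)) with h | h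
  · exact h.le
  · exact h.1.ge

/-- The projection `P` at `t₀` rotates rigidly to the left of `t₀`. If it lies on the imaginary
axis, its real part grows like `sin(t₀ - t) Im P`, and `sin x ≥ 2x/π` gives the constant. -/
lemma decayRate_left {N : ℕ} {δ : Param N} (hδ : δ ∈ starD N) (t₀ : ℝ) :
    ∃ κ > 0, ∀ᶠ t : ℝ in 𝓝[<] t₀, κ * |t - t₀| ≤ decayRate δ t := by
  have hP := hδ.2 _ (Complex.exp_ne_zero (Complex.I * t₀))
  set P := proj (M (Complex.exp (Complex.I * t₀)) δ) with hPdef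
  rcases hP with hP | ⟨h0, hP⟩
  · refine ⟨1, one_pos, ?_⟩
    filter_upwards [proj_M_left δ t₀,
      (abs_le_re_of_re_pos hP t₀).filter_mono nhdsWithin_le_nhds] with t h1 h2
    rwa [decayRate_eq_re_proj, h1, one_mul]
  · refine ⟨2 / Real.pi * P.im, by positivity, ?_⟩
    filter_upwards [proj_M_left δ t₀, Ioo_mem_nhdsLT (show t₀ - 1 < t₀ by linarith)] with t h1 ht
    rw [decayRate_eq_re_proj, h1, ← hPdef, exp_mul_re, h0, abs_of_neg (by linarith [ht.2])]
    have := Real.mul_le_sin (x := -(t - t₀)) (by linarith [ht.2])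
      (by linarith [ht.1, Real.pi_gt_three])
    rw [Real.sin_neg] at this
    nlinarith

lemma decayRate_right {N : ℕ} {δ : Param N} (hδ : δ ∈ starD N) (t₀ : ℝ) :
    ∃ κ > 0, ∀ᶠ t : ℝ in 𝓝[>] t₀, κ * |t - t₀| ≤ decayRate δ t := by
  obtain ⟨P, hP⟩ := proj_M_right δ t₀
  -- `P` is a one-sided limit of projections, all of which lie in `cone`, so its real part is only
  -- known to be nonnegative.
  have hre : 0 ≤ P.re := by
    have h1 : Tendsto (fun t : ℝ => (Complex.exp (Complex.I * (t - t₀ : ℝ)) * P).re)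
        (𝓝[>] t₀) (𝓝 P.re) := by
      have := (continuous_exp_mul_re t₀ P).tendsto t₀
      simp only [sub_self, Complex.ofReal_zero, mul_zero, Complex.exp_zero, one_mul] at this
      exact this.mono_left nhdsWithin_le_nhds
    refine ge_of_tendsto h1 ?_
    filter_upwards [hP] with t ht
    rw [← ht, ← decayRate_eq_re_proj]
    exact decayRate_nonneg hδ t
  rcases hre.lt_or_eq with h | h
  · refine ⟨1, one_pos, ?_⟩
    filter_upwards [hP, (abs_le_re_of_re_pos h t₀).filter_mono nhdsWithin_le_nhds] with t h1 h2
    rwa [decayRate_eq_re_proj, h1, one_mul]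
  · have hI := Ioo_mem_nhdsGT (show t₀ < t₀ + 1 by linarith)
    -- A purely imaginary `P` that enters `cone` under counterclockwise rotation must point
    -- downwards.
    have him : P.im < 0 := by
      obtain ⟨t, ht, ht'⟩ := (hP.and hI).exists
      have hc := hδ.2 _ (Complex.exp_ne_zero (Complex.I * t))
      have hs : 0 < Real.sin (t - t₀) :=
        Real.sin_pos_of_pos_of_lt_pi (by linarith [ht'.1]) (by linarith [ht'.2, Real.pi_gt_three])
      rw [ht] at hc
      simp only [cone, Set.mem_ofPred_eq, exp_mul_re, exp_mul_im, ← h, mul_zero, zero_sub,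
        add_zero] at hc
      rcases hc with hc | ⟨hc, hc'⟩
      · by_contra! h'
        nlinarith
      · rcases mul_eq_zero.1 (neg_eq_zero.1 hc) with h' | h'
        · exact absurd h' hs.ne'
        · simp [h'] at hc'
    refine ⟨2 / Real.pi * (-P.im), mul_pos (by positivity) (by linarith), ?_⟩
    filter_upwards [hP, hI] with t h1 ht
    rw [decayRate_eq_re_proj, h1, exp_mul_re, ← h, abs_of_pos (by linarith [ht.1])]
    have := Real.mul_le_sin (x := t - t₀) (by linarith [ht.1])
      (by linarith [ht.2, Real.pi_gt_three])
    nlinarith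

/-- The decay rate vanishes at most to first order. This bound is all that the analysis below takes
from the stability condition. -/
lemma exists_mul_abs_le_decayRate {N : ℕ} {δ : Param N} (hδ : δ ∈ starD N) (t₀ : ℝ) :
    ∃ κ > 0, ∀ᶠ t : ℝ in 𝓝 t₀, κ * |t - t₀| ≤ decayRate δ t := by
  obtain ⟨κ₁, h1, hl⟩ := decayRate_left hδ t₀
  obtain ⟨κ₂, h2, hr⟩ := decayRate_right hδ t₀
  refine ⟨min κ₁ κ₂, lt_min h1 h2, ?_⟩
  have h : ∀ᶠ t : ℝ in 𝓝[≠] t₀, min κ₁ κ₂ * |t - t₀| ≤ decayRate δ t := by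
    rw [← nhdsLT_sup_nhdsGT, eventually_sup]
    exact ⟨hl.mono fun t ht => le_trans (by gcongr; exact min_le_left _ _) ht,
      hr.mono fun t ht => le_trans (by gcongr; exact min_le_right _ _) ht⟩
  have h0 : min κ₁ κ₂ * |t₀ - t₀| ≤ decayRate δ t₀ := by simpa using decayRate_nonneg hδ t₀
  rw [eventually_nhdsWithin_iff] at h
  filter_upwards [h] with t ht
  rcases eq_or_ne t t₀ with rfl | hne
  · exact h0
  · exact ht hne

/-- A direction along which `F_N` decays exponentially and which contains no poles. -/
def IsRegularAngle {N : ℕ} (δ : Param N) (t : ℝ) : Prop :=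
  0 < decayRate δ t ∧ ∀ l, δ.2.1 l = 0 ∨ (Complex.exp (Complex.I * t) * δ.2.1 l).re ≠ 0

lemma eventually_re_ne_zero {b : ℂ} (hb : b ≠ 0) (t₀ : ℝ) :
    ∀ᶠ t : ℝ in 𝓝[≠] t₀, (Complex.exp (Complex.I * t) * b).re ≠ 0 := by
  have hc : Continuous fun t : ℝ => (Complex.exp (Complex.I * t) * b).re := by fun_prop
  by_cases h0 : (Complex.exp (Complex.I * t₀) * b).re = 0
  · set P := Complex.exp (Complex.I * t₀) * b
    have hP : P.im ≠ 0 := fun h => mul_ne_zero (Complex.exp_ne_zero _) hb (Complex.ext h0 h)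
    filter_upwards [self_mem_nhdsWithin, nhdsWithin_le_nhds (Ioo_mem_nhds
      (show t₀ - 1 < t₀ by linarith) (show t₀ < t₀ + 1 by linarith))] with t hne ht
    rw [exp_I_mul_eq t t₀, exp_mul_re, h0, mul_zero, zero_sub, neg_ne_zero]
    refine mul_ne_zero (fun h => hne ?_) hP
    have := (Real.sin_eq_zero_iff_of_lt_of_lt (x := t - t₀)
      (by linarith [ht.1, Real.pi_gt_three]) (by linarith [ht.2, Real.pi_gt_three])).1 h
    simpa using sub_eq_zero.1 this
  · exact (hc.continuousAt.eventually_ne h0).filter_mono nhdsWithin_le_nhds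

/-- Zeros of the decay rate and of each `Re(e^{it} a_ℓ)` with `a_ℓ ≠ 0` are isolated, so every
direction can be made regular by a small rotation. -/
lemma eventually_isRegularAngle {N : ℕ} {δ : Param N} (hδ : δ ∈ starD N) (t₀ : ℝ) :
    ∀ᶠ t : ℝ in 𝓝[≠] t₀, IsRegularAngle δ t := by
  obtain ⟨κ, hκ, h⟩ := exists_mul_abs_le_decayRate hδ t₀
  have h2 : ∀ l, ∀ᶠ t : ℝ in 𝓝[≠] t₀,
      δ.2.1 l = 0 ∨ (Complex.exp (Complex.I * t) * δ.2.1 l).re ≠ 0 := by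
    intro l
    by_cases hl : δ.2.1 l = 0
    · exact Eventually.of_forall fun _ => Or.inl hl
    · exact (eventually_re_ne_zero hl t₀).mono fun _ => Or.inr
  filter_upwards [eventually_all.2 h2, h.filter_mono nhdsWithin_le_nhds, self_mem_nhdsWithin]
    with t h1 h3 hne
  exact ⟨(mul_pos hκ (abs_pos.2 (sub_ne_zero.2 hne))).trans_le h3, h1⟩

/-! ### Bounds and regularity of `F_N` -/

/-- If `exp(-v)` is close to `1`, its principal logarithm is small by continuity, and this logarithm
differs from `-v` by a multiple of `2πi`. Hence `c` is uniform in `v`. -/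
lemma exists_le_norm_one_sub_exp {d : ℝ} (hd : 0 < d) : ∃ c > 0, ∀ v : ℂ,
    (∀ n : ℤ, d ≤ ‖v - 2 * Real.pi * Complex.I * n‖) → c ≤ ‖1 - Complex.exp (-v)‖ := by
  have h1 : ContinuousAt Complex.log 1 := continuousAt_clog Complex.one_mem_slitPlane
  obtain ⟨c, hc, h⟩ := Metric.continuousAt_iff.1 h1 d hd
  refine ⟨c, hc, fun v hv => ?_⟩
  by_contra! hlt
  have h2 : dist (Complex.exp (-v)) 1 < c := by rwa [dist_comm, dist_eq_norm]
  have h3 := h h2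
  rw [Complex.log_one, dist_zero_right] at h3
  obtain ⟨n, hn⟩ := Complex.exp_eq_exp_iff_exists_int.1 (Complex.exp_log (Complex.exp_ne_zero (-v)))
  refine absurd (hv n) (not_le.2 ?_)
  rwa [hn, ← norm_neg, show -(-v + n * (2 * Real.pi * Complex.I)) =
    v - 2 * Real.pi * Complex.I * n by ring] at h3

/-- The identity `1 - e^{-z} = -e^{-z}(1 - e^{z})` turns the lower bound at `-z` into one that grows
like `e^{-Re z}`. The better of the two bounds gives the maximum in the exponent. -/
lemma norm_factor_le {d : ℝ} (hd : 0 < d) (θ : ℝ) : ∃ C > 0, ∀ v : ℂ,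
    (∀ n : ℤ, d ≤ ‖v - 2 * Real.pi * Complex.I * (θ + n)‖) →
    ‖(1 - e θ * Complex.exp (-v))⁻¹‖ ≤ C * Real.exp (-max 0 (-v.re)) := by
  obtain ⟨c, hc, h⟩ := exists_le_norm_one_sub_exp hd
  refine ⟨c⁻¹, inv_pos.2 hc, fun v hv => ?_⟩
  set z := v - 2 * Real.pi * Complex.I * θ with hz
  have hzre : z.re = v.re := by simp [hz]
  have heq : e θ * Complex.exp (-v) = Complex.exp (-z) := by
    rw [e, ← Complex.exp_add, hz]; ring_nf
  have h1 : c ≤ ‖1 - Complex.exp (-z)‖ := h z fun n => by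
    convert hv n using 2; rw [hz]; ring
  have h2 : c ≤ ‖1 - Complex.exp (- -z)‖ := h (-z) fun n => by
    convert hv (-n) using 1; rw [← norm_neg, hz]; push_cast; ring_nf
  have h3 : Real.exp (-v.re) * c ≤ ‖1 - Complex.exp (-z)‖ := by
    have : 1 - Complex.exp (-z) = -(Complex.exp (-z) * (1 - Complex.exp (- -z))) := by
      rw [mul_sub, ← Complex.exp_add]; simp
    rw [this, norm_neg, norm_mul, Complex.norm_exp, Complex.neg_re, hzre]
    gcongr
  rw [heq, norm_inv, Real.exp_neg, ← mul_inv]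
  refine inv_anti₀ (by positivity) ?_
  rcases max_choice 0 (-v.re) with h' | h' <;> rw [h']
  · simpa using h1
  · rwa [mul_comm]

lemma norm_F_le {N : ℕ} (δ : Param N) (d : Fin N → ℝ) (hd : ∀ l, δ.2.1 l ≠ 0 → 0 < d l) :
    ∃ C > 0, ∀ u : ℂ,
      (∀ l, δ.2.1 l ≠ 0 → ∀ n : ℤ,
        d l ≤ ‖u * δ.2.1 l - 2 * Real.pi * Complex.I * (δ.2.2 l + n)‖) →
      ‖F u δ‖ ≤ C * Real.exp (-((u * δ.1).re + ∑ l, max 0 (-(u * δ.2.1 l).re))) := by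
  have h : ∀ l, ∃ C > 0, ∀ u : ℂ, (δ.2.1 l ≠ 0 → ∀ n : ℤ,
      d l ≤ ‖u * δ.2.1 l - 2 * Real.pi * Complex.I * (δ.2.2 l + n)‖) →
      ‖(1 - e (δ.2.2 l) * Complex.exp (-(u * δ.2.1 l)))⁻¹‖ ≤
        C * Real.exp (-max 0 (-(u * δ.2.1 l).re)) := by
    intro l
    by_cases hl : δ.2.1 l = 0
    · refine ⟨‖(1 - e (δ.2.2 l))⁻¹‖ + 1, by positivity, fun u _ => ?_⟩
      simp [hl]
    · obtain ⟨C, hC, h⟩ := norm_factor_le (hd l hl) (δ.2.2 l)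
      exact ⟨C, hC, fun u hu => h _ (hu hl)⟩
  choose C hC h using h
  refine ⟨∏ l, C l, Finset.prod_pos fun l _ => hC l, fun u hu => ?_⟩
  rw [F, norm_mul, norm_prod, Complex.norm_exp, neg_add, Real.exp_add, ← Finset.sum_neg_distrib,
    Real.exp_sum, mul_left_comm, ← Finset.prod_mul_distrib, Complex.neg_re]
  gcongr with l
  exact h l u (hu l)

lemma exponent_polar {N : ℕ} (δ : Param N) (x t : ℝ) (hx : 0 ≤ x) :
    (x * Complex.exp (Complex.I * t) * δ.1).re +
      ∑ l, max 0 (-(x * Complex.exp (Complex.I * t) * δ.2.1 l).re) = x * decayRate δ t := by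
  simp only [mul_assoc, Complex.re_ofReal_mul]
  rw [decayRate, mul_add, Finset.mul_sum]
  congr 1
  refine Finset.sum_congr rfl fun l _ => ?_
  rw [mul_max_of_nonneg _ _ hx, mul_zero, mul_neg]

/-- At the singularities of a factor `u a_ℓ` is purely imaginary, whereas on a regular ray `|Re(u
a_ℓ)|` is at least `r|Re(e^{it} a_ℓ)| > 0`. -/
lemma norm_F_ray_le {N : ℕ} {δ : Param N} {t r : ℝ} (ht : IsRegularAngle δ t) (hr : 0 < r) :
    ∃ C > 0, ∀ x ≥ r, ‖F (x * Complex.exp (Complex.I * t)) δ‖ ≤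
      C * Real.exp (-(x * decayRate δ t)) := by
  obtain ⟨C, hC, h⟩ := norm_F_le δ (fun l => r * |(Complex.exp (Complex.I * t) * δ.2.1 l).re|)
    fun l hl => mul_pos hr (abs_pos.2 ((ht.2 l).resolve_left hl))
  refine ⟨C, hC, fun x hx => ?_⟩
  rw [← exponent_polar δ x t (hr.le.trans hx)]
  refine h _ fun l hl n => ?_
  refine le_trans ?_ (Complex.abs_re_le_norm _)
  have : (x * Complex.exp (Complex.I * t) * δ.2.1 l -
      2 * Real.pi * Complex.I * (δ.2.2 l + n)).re =
      x * (Complex.exp (Complex.I * t) * δ.2.1 l).re := by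
    rw [Complex.sub_re, mul_assoc (x : ℂ), Complex.re_ofReal_mul]
    simp
  rw [this, abs_mul, abs_of_pos (hr.trans_le hx)]
  gcongr

lemma two_pi_I_ne_zero : (2 * Real.pi * Complex.I : ℂ) ≠ 0 := by
  simp [Real.pi_ne_zero]

/-- Membership in `bigD` excludes `a_ℓ = 0`, since then `θ_ℓ` would have to be an integer. -/
lemma mem_poles_iff {N : ℕ} {δ : Param N} (hδ : δ ∈ bigD N) {u : ℂ} :
    u ∈ poles δ ↔ u ≠ 0 ∧ ∃ l, δ.2.1 l ≠ 0 ∧ ∃ n : ℤ,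
      u = 2 * Real.pi * Complex.I * (δ.2.2 l + n) / δ.2.1 l := by
  rw [mem_poles]
  refine and_congr_right fun _ => exists_congr fun l => ?_
  rw [e_eq_exp_iff]
  constructor
  · rintro ⟨n, hn⟩
    have ha : δ.2.1 l ≠ 0 := by
      intro ha
      rw [ha, mul_zero, eq_comm, mul_eq_zero] at hn
      have := hn.resolve_left two_pi_I_ne_zero
      refine hδ l ha (-n) ?_
      push_cast
      exact_mod_cast eq_neg_of_add_eq_zero_left this
    exact ⟨ha, n, by rw [← hn]; field_simp⟩
  · rintro ⟨ha, n, rfl⟩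
    exact ⟨n, by field_simp⟩

lemma norm_F_circle_le {N : ℕ} {δ : Param N} (hδ : δ ∈ bigD N) {c : ℝ} (hc : 0 < c) :
    ∃ C > 0, ∀ R ≥ 1, (∀ u ∈ poles δ, c ≤ |‖u‖ - R|) → ∀ t : ℝ,
      ‖F (R * Complex.exp (Complex.I * t)) δ‖ ≤ C * Real.exp (-(R * decayRate δ t)) := by
  -- The minimum with `1` accounts for a possible zero of the denominator at `u = 0`: it does not
  -- count among `poles`, but its distance from the circle is `R ≥ 1`.
  obtain ⟨C, hC, h⟩ := norm_F_le δ (fun l => min c 1 * ‖δ.2.1 l‖)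
    fun l hl => mul_pos (lt_min hc one_pos) (norm_pos_iff.2 hl)
  refine ⟨C, hC, fun R hR hp t => ?_⟩
  rw [← exponent_polar δ R t (by linarith)]
  refine h _ fun l hl n => ?_
  set u : ℂ := R * Complex.exp (Complex.I * t)
  have hu : ‖u‖ = R := by
    simp [u, Complex.norm_exp, abs_of_nonneg (zero_le_one.trans hR)]
  set p : ℂ := 2 * Real.pi * Complex.I * (δ.2.2 l + n) / δ.2.1 l
  have : u * δ.2.1 l - 2 * Real.pi * Complex.I * (δ.2.2 l + n) = (u - p) * δ.2.1 l := by
    simp only [p]; field_simp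
  rw [this, norm_mul]
  gcongr
  by_cases hp0 : p = 0
  · rw [hp0, sub_zero, hu]
    exact (min_le_right _ _).trans hR
  · have := hp p ((mem_poles_iff hδ).2 ⟨hp0, l, hl, n, rfl⟩)
    refine (min_le_left _ _).trans (this.trans ?_)
    rw [← hu, norm_sub_rev]
    exact abs_norm_sub_norm_le p u

lemma differentiableAt_F {N : ℕ} {δ : Param N} {u : ℂ} (h0 : u ≠ 0) (hu : u ∉ poles δ) :
    DifferentiableAt ℂ (fun u => F u δ) u := by
  unfold F
  have : ∀ l, 1 - e (δ.2.2 l) * Complex.exp (-(u * δ.2.1 l)) ≠ 0 := fun l hl => hu ⟨h0, l, hl⟩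
  refine DifferentiableAt.mul (by fun_prop) (DifferentiableAt.fun_finsetProd fun l _ => ?_)
  exact DifferentiableAt.inv (by fun_prop) (this l)

lemma meromorphicAt_F {N : ℕ} (δ : Param N) (u : ℂ) : MeromorphicAt (fun u => F u δ) u := by
  unfold F
  refine MeromorphicAt.mul (f := fun u => Complex.exp (-(u * δ.1)))
    (g := fun u => ∏ l, (1 - e (δ.2.2 l) * Complex.exp (-(u * δ.2.1 l)))⁻¹)
    (AnalyticAt.meromorphicAt (by fun_prop)) (MeromorphicAt.fun_prod fun l _ => ?_)
  exact MeromorphicAt.inv (f := fun u => 1 - e (δ.2.2 l) * Complex.exp (-(u * δ.2.1 l)))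
    (AnalyticAt.meromorphicAt (by fun_prop))

lemma notMem_poles_of_isRegularAngle {N : ℕ} {δ : Param N} (hδ : δ ∈ bigD N) {t : ℝ}
    (ht : IsRegularAngle δ t) (x : ℝ) : (x * Complex.exp (Complex.I * t) : ℂ) ∉ poles δ := by
  intro hu
  obtain ⟨h0, l, hl, n, hn⟩ := (mem_poles_iff hδ).1 hu
  rw [eq_div_iff hl, mul_assoc] at hn
  have := congrArg Complex.re hn
  rw [Complex.re_ofReal_mul] at this
  have h2 : (2 * Real.pi * Complex.I * (δ.2.2 l + n) : ℂ).re = 0 := by simp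
  rw [h2, mul_eq_zero] at this
  rcases this with h | h
  · simp [h] at h0
  · exact (ht.2 l).elim hl fun h' => h' h

/-! ### The distribution of the poles -/

lemma finite_poles_lt {N : ℕ} {δ : Param N} (hδ : δ ∈ bigD N) (R : ℝ) :
    {u | u ∈ poles δ ∧ ‖u‖ < R}.Finite := by
  refine (Set.finite_iUnion fun l : Fin N => ((Set.finite_Icc
    ⌈-(R * ‖δ.2.1 l‖ / (2 * Real.pi)) - δ.2.2 l⌉ ⌊R * ‖δ.2.1 l‖ / (2 * Real.pi) - δ.2.2 l⌋).image
      fun n : ℤ => 2 * Real.pi * Complex.I * (δ.2.2 l + n) / δ.2.1 l)).subset ?_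
  rintro u ⟨hu, hR⟩
  obtain ⟨h0, l, hl, n, rfl⟩ := (mem_poles_iff hδ).1 hu
  refine Set.mem_iUnion.2 ⟨l, n, ?_, rfl⟩
  have hn : ‖(2 * Real.pi * Complex.I * (δ.2.2 l + n) : ℂ)‖ = 2 * Real.pi * |δ.2.2 l + n| := by
    rw [← Complex.ofReal_intCast, ← Complex.ofReal_add, norm_mul, Complex.norm_real]
    simp [abs_of_pos Real.pi_pos]
  rw [norm_div, hn, div_lt_iff₀ (norm_pos_iff.2 hl)] at hR
  have h2 : |δ.2.2 l + n| < R * ‖δ.2.1 l‖ / (2 * Real.pi) := by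
    rw [lt_div_iff₀ (by positivity)]; linarith
  rw [abs_lt] at h2
  exact ⟨Int.ceil_le.2 (by linarith), Int.le_floor.2 (by linarith)⟩

/-- Induction on the number of progressions. A window no longer than the step of the new progression
cannot have terms of it in both open halves, so one half remains free. -/
lemma exists_gap_of_progressions (S : Finset (ℝ × ℝ)) (hS : ∀ p ∈ S, 0 < p.2) {η : ℝ}
    (hη : 0 < η) : ∃ c > 0, ∀ X : ℝ, ∃ Y, X ≤ Y ∧ Y + c ≤ X + η ∧
      ∀ p ∈ S, ∀ n : ℤ, p.1 + n * p.2 ∉ Set.Ioo Y (Y + c) := by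
  classical
  induction S using Finset.induction_on with
  | empty => exact ⟨η, hη, fun X => ⟨X, le_rfl, le_rfl, by simp⟩⟩
  | insert p S _ ih =>
    obtain ⟨c, hc, h⟩ := ih fun q hq => hS q (Finset.mem_insert_of_mem hq)
    have hp := hS p (Finset.mem_insert_self _ _)
    have hc1 := min_le_left c p.2
    have hc2 := min_le_right c p.2
    have hc3 : 0 < min c p.2 := lt_min hc hp
    refine ⟨min c p.2 / 2, by positivity, fun X => ?_⟩
    obtain ⟨Y, h1, h2, h3⟩ := h X
    by_cases hY : ∃ n : ℤ, p.1 + n * p.2 ∈ Set.Ioo Y (Y + min c p.2 / 2)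
    · obtain ⟨n, hn⟩ := hY
      refine ⟨Y + min c p.2 / 2, by linarith, by linarith, fun q hq m hm => ?_⟩
      rcases Finset.mem_insert.1 hq with rfl | hq
      · have h4 : 0 < ((m - n : ℤ) : ℝ) * q.2 := by push_cast; linarith [hm.1, hn.2]
        have h5 : ((m - n : ℤ) : ℝ) * q.2 < 1 * q.2 := by push_cast; linarith [hm.2, hn.1]
        have h6 : 0 < m - n := by exact_mod_cast pos_of_mul_pos_left h4 hp.le
        have h7 : m - n < 1 := by exact_mod_cast lt_of_mul_lt_mul_right h5 hp.le
        omega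
      · exact h3 q hq m ⟨by linarith [hm.1], by linarith [hm.2]⟩
    · refine ⟨Y, h1, by linarith, fun q hq m hm => ?_⟩
      rcases Finset.mem_insert.1 hq with rfl | hq
      · exact hY ⟨m, hm⟩
      · exact h3 q hq m ⟨hm.1, by linarith [hm.2]⟩

lemma farRadii_neBot {N : ℕ} {δ : Param N} (hδ : δ ∈ bigD N) : (farRadii δ).NeBot := by
  classical
  set g : Fin N → ℝ := fun l => 2 * Real.pi / ‖δ.2.1 l‖
  set I : Finset (Fin N) := {l | δ.2.1 l ≠ 0}
  -- The moduli of the poles are `|θ_ℓ + n| · 2π/‖a_ℓ‖`. They lie in two progressions per index, one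
  -- for each sign of `θ_ℓ + n`, and the midpoint of a common gap is an admissible radius.
  obtain ⟨c, hc, h⟩ := exists_gap_of_progressions
    (I.image (fun l => (δ.2.2 l * g l, g l)) ∪ I.image (fun l => (-(δ.2.2 l) * g l, g l)))
    (by
      have : ∀ l ∈ I, 0 < g l := fun l hl =>
        div_pos (by positivity) (norm_pos_iff.2 (by simpa [I] using hl))
      intro p hp
      simp only [Finset.mem_union, Finset.mem_image] at hp
      rcases hp with ⟨l, hl, rfl⟩ | ⟨l, hl, rfl⟩ <;> exact this l hl) one_pos
  refine NeBot.mono ?_ (le_iSup₂ (c / 2) (Set.mem_Ioi.2 (half_pos hc)))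
  rw [← frequently_mem_iff_neBot, frequently_atTop]
  intro X
  obtain ⟨Y, h1, h2, h3⟩ := h X
  refine ⟨Y + c / 2, by linarith, fun u hu => ?_⟩
  obtain ⟨h0, l, hl, n, rfl⟩ := (mem_poles_iff hδ).1 hu
  have hn : ‖2 * Real.pi * Complex.I * (δ.2.2 l + n) / δ.2.1 l‖ = |δ.2.2 l + n| * g l := by
    rw [← Complex.ofReal_intCast, ← Complex.ofReal_add, norm_div, norm_mul, Complex.norm_real]
    simp [abs_of_pos Real.pi_pos, g]
    ring
  have hlI : l ∈ I := by simpa [I] using hl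
  rw [hn]
  by_contra! hlt
  rw [abs_lt] at hlt
  rcases abs_choice (δ.2.2 l + n) with h' | h' <;> rw [h'] at hlt
  · refine h3 (δ.2.2 l * g l, g l)
      (Finset.mem_union_left _ (Finset.mem_image_of_mem _ hlI)) n ⟨?_, ?_⟩ <;>
    · simp only; nlinarith
  · refine h3 (-(δ.2.2 l) * g l, g l)
      (Finset.mem_union_right _ (Finset.mem_image_of_mem _ hlI)) (-n) ⟨?_, ?_⟩ <;>
    · simp only; push_cast; nlinarith

/-! ### Residues -/

/-- `g` has an isolated singularity at `u₀` with residue `c`: up to `c / (u - u₀)` and a function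
analytic at `u₀`, it is there the derivative of a function holomorphic off `u₀`. -/
def HasResidue (g : ℂ → ℂ) (u₀ c : ℂ) : Prop :=
  ∃ q h : ℂ → ℂ, DifferentiableOn ℂ q {u₀}ᶜ ∧ AnalyticAt ℂ h u₀ ∧
    ∀ᶠ u in 𝓝[≠] u₀, g u = c / (u - u₀) + deriv q u + h u

/-- On every small circle the polar term gives `2πi c`, the derivative of `q` integrates to `0`
because `q` is a primitive, and the analytic part by Cauchy's theorem. -/
lemma HasResidue.residue_eq {g : ℂ → ℂ} {u₀ c : ℂ} (H : HasResidue g u₀ c) :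
    residue g u₀ = c := by
  obtain ⟨q, h, hq, hh, heq⟩ := H
  refine Tendsto.limUnder_eq (tendsto_const_nhds.congr' ?_)
  rw [eventually_nhdsWithin_iff] at heq
  obtain ⟨ρ, hρ, hball⟩ := Metric.eventually_nhds_iff_ball.1 (heq.and hh.eventually_analyticAt)
  filter_upwards [Ioo_mem_nhdsGT hρ] with r hr
  have hr0 := hr.1
  have hsphere : ∀ u ∈ Metric.sphere u₀ r, u ≠ u₀ ∧ u ∈ Metric.ball u₀ ρ := by
    intro u hu
    rw [mem_sphere_iff_norm] at hu
    refine ⟨fun h => ?_, by rw [mem_ball_iff_norm, hu]; exact hr.2⟩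
    rw [h, sub_self, norm_zero] at hu
    exact hr0.ne hu
  have hopen : IsOpen ({u₀}ᶜ : Set ℂ) := isOpen_compl_singleton
  have hc1 : ContinuousOn (fun u => c / (u - u₀)) (Metric.sphere u₀ r) :=
    continuousOn_const.div (by fun_prop) fun u hu => sub_ne_zero.2 (hsphere u hu).1
  have hc2 : ContinuousOn (deriv q) (Metric.sphere u₀ r) := fun u hu =>
    ((hq.analyticAt (hopen.mem_nhds (hsphere u hu).1)).deriv.continuousAt).continuousWithinAt
  have hc3 : ContinuousOn h (Metric.sphere u₀ r) := fun u hu =>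
    (hball u (hsphere u hu).2).2.continuousAt.continuousWithinAt
  have i1 : CircleIntegrable (fun u => c / (u - u₀)) u₀ r := hc1.circleIntegrable hr0.le
  have i2 : CircleIntegrable (deriv q) u₀ r := hc2.circleIntegrable hr0.le
  have i3 : CircleIntegrable h u₀ r := hc3.circleIntegrable hr0.le
  have e1 : (∮ u in C(u₀, r), c / (u - u₀)) = c * (2 * Real.pi * Complex.I) := by
    simp only [div_eq_mul_inv]
    rw [circleIntegral.integral_const_mul, circleIntegral.integral_sub_center_inv _ hr0.ne']
  have e2 : (∮ u in C(u₀, r), deriv q u) = 0 :=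
    circleIntegral.integral_eq_zero_of_hasDerivWithinAt (f := q) hr0.le fun u hu =>
      ((hq.differentiableAt (hopen.mem_nhds (hsphere u hu).1)).hasDerivAt).hasDerivWithinAt
  have e3 : (∮ u in C(u₀, r), h u) = 0 := by
    have hd : ∀ u ∈ Metric.closedBall u₀ r, DifferentiableAt ℂ h u := fun u hu =>
      (hball u (Metric.closedBall_subset_ball hr.2 hu)).2.differentiableAt
    exact Complex.circleIntegral_eq_zero_of_differentiable_on_off_countable hr0.le
      Set.countable_empty (fun u hu => (hd u hu).continuousAt.continuousWithinAt)
      fun u hu => hd u (Metric.ball_subset_closedBall hu.1)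
  have e4 : (∮ u in C(u₀, r), g u) = ∮ u in C(u₀, r), (c / (u - u₀) + deriv q u + h u) :=
    circleIntegral.integral_congr hr0.le fun u hu =>
      (hball u (hsphere u hu).2).1 (hsphere u hu).1
  have e5 := circleIntegral.integral_add (i1.add i2) i3
  have e6 := circleIntegral.integral_add i1 i2
  simp only [Pi.add_apply] at e5 e6
  rw [e4, e5, e6, e1, e2, e3, add_zero, add_zero, mul_comm c, inv_mul_cancel_left₀ two_pi_I_ne_zero]

lemma analyticAt_dslope {A : ℂ → ℂ} {u₀ : ℂ} (hA : AnalyticAt ℂ A u₀) :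
    AnalyticAt ℂ (dslope A u₀) u₀ := by
  obtain ⟨s, hs, h⟩ := hA.eventually_analyticAt.exists_mem
  refine DifferentiableOn.analyticAt (s := s) ?_ hs
  exact (Complex.differentiableOn_dslope hs).2 fun u hu =>
    (h u hu).differentiableAt.differentiableWithinAt

/-- Splitting off the leading term `A(u₀)/(u - u₀)^{n+1}` lowers the order. For `n ≥ 1` this term
has a primitive and goes into `q`; for `n = 0` it adds `A(u₀)` to the residue. -/
lemma exists_hasResidue_of_eq_div_pow {u₀ : ℂ} (n : ℕ) : ∀ {A g : ℂ → ℂ}, AnalyticAt ℂ A u₀ →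
    (∀ᶠ u in 𝓝[≠] u₀, g u = A u / (u - u₀) ^ n) → ∃ c, HasResidue g u₀ c := by
  induction n with
  | zero =>
    intro A g hA hg
    refine ⟨0, fun _ => 0, A, by fun_prop, hA, hg.mono fun u hu => ?_⟩
    simp [hu]
  | succ n ih =>
    intro A g hA hg
    obtain ⟨c, q, h, hq, hh, heq⟩ := ih (g := fun u => dslope A u₀ u / (u - u₀) ^ n)
      (analyticAt_dslope hA) (Eventually.of_forall fun _ => rfl)
    have hsplit : ∀ u, u ≠ u₀ → A u / (u - u₀) ^ (n + 1) =
        dslope A u₀ u / (u - u₀) ^ n + A u₀ / (u - u₀) ^ (n + 1) := by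
      intro u hu
      have h1 := sub_smul_dslope A u₀ u
      have h2 : u - u₀ ≠ 0 := sub_ne_zero.2 hu
      rw [smul_eq_mul] at h1
      rw [div_add_div _ _ (pow_ne_zero _ h2) (pow_ne_zero _ h2),
        div_eq_div_iff (pow_ne_zero _ h2) (mul_ne_zero (pow_ne_zero _ h2) (pow_ne_zero _ h2))]
      linear_combination -(u - u₀) ^ n * (u - u₀) ^ (n + 1) * h1
    rcases Nat.eq_zero_or_pos n with rfl | hn
    · refine ⟨c + A u₀, q, h, hq, hh, ?_⟩
      filter_upwards [hg, heq, self_mem_nhdsWithin] with u h1 h2 h3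
      rw [h1, hsplit u h3, h2, zero_add, pow_one]
      ring
    · have hd : ∀ u, u ≠ u₀ → HasDerivAt (fun u => -(A u₀ / n) * ((u - u₀) ^ n)⁻¹)
          (A u₀ / (u - u₀) ^ (n + 1)) u := by
        intro u hu
        have h2 : u - u₀ ≠ 0 := sub_ne_zero.2 hu
        have hn' : (n : ℂ) ≠ 0 := by exact_mod_cast hn.ne'
        have hp : HasDerivAt (fun u => (u - u₀) ^ n) (n * (u - u₀) ^ (n - 1)) u := by
          simpa using! ((hasDerivAt_id u).sub_const u₀).fun_pow n
        convert! (hp.fun_inv (pow_ne_zero n h2)).const_mul (-(A u₀ / n)) using 1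
        obtain ⟨m, rfl⟩ : ∃ m, n = m + 1 := ⟨n - 1, by omega⟩
        rw [Nat.add_sub_cancel]
        field_simp
        ring
      refine ⟨c, fun u => q u + -(A u₀ / n) * ((u - u₀) ^ n)⁻¹, h, fun u hu => ?_, hh, ?_⟩
      · exact (hq u hu).add (hd u hu).differentiableAt.differentiableWithinAt
      · filter_upwards [hg, heq, self_mem_nhdsWithin] with u h1 h2 h3
        rw [h1, hsplit u h3, h2]
        have hqd := (hq.differentiableAt (isOpen_compl_singleton.mem_nhds h3)).hasDerivAt
        rw [(hqd.fun_add (hd u h3)).deriv]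
        ring

lemma hasResidue_of_meromorphicAt {g : ℂ → ℂ} {u₀ : ℂ} (hg : MeromorphicAt g u₀) :
    HasResidue g u₀ (residue g u₀) := by
  obtain ⟨n, hn⟩ := hg
  obtain ⟨c, hc⟩ := exists_hasResidue_of_eq_div_pow n (g := g) hn (by
    filter_upwards [self_mem_nhdsWithin] with u hu
    have : u - u₀ ≠ 0 := sub_ne_zero.2 hu
    rw [smul_eq_mul]
    field_simp)
  rwa [hc.residue_eq]

/-! ### Integrals over the boundary of a rectangle -/

/-- The integral of `f` over the positively oriented boundary of `[x₁, x₂] × [y₁, y₂]`. -/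
noncomputable def rectInt (f : ℂ → ℂ) (x₁ x₂ y₁ y₂ : ℝ) : ℂ :=
  (∫ x : ℝ in x₁..x₂, f (x + y₁ * Complex.I)) - (∫ x : ℝ in x₁..x₂, f (x + y₂ * Complex.I)) +
    Complex.I * (∫ y : ℝ in y₁..y₂, f (x₂ + y * Complex.I)) -
    Complex.I * ∫ y : ℝ in y₁..y₂, f (x₁ + y * Complex.I)

/-- The boundary of `[x₁, x₂] × [y₁, y₂]`. -/
def rectBd (x₁ x₂ y₁ y₂ : ℝ) : Set ℂ :=
  {z | z.re ∈ Set.Icc x₁ x₂ ∧ z.im ∈ Set.Icc y₁ y₂ ∧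
    (z.re = x₁ ∨ z.re = x₂ ∨ z.im = y₁ ∨ z.im = y₂)}

section Rect

variable {x₁ x₂ y₁ y₂ : ℝ}

lemma rectBd_bottom (hy : y₁ ≤ y₂) {x : ℝ} (h : x ∈ Set.Icc x₁ x₂) :
    (x + y₁ * Complex.I : ℂ) ∈ rectBd x₁ x₂ y₁ y₂ := by
  simp [rectBd, h.1, h.2, hy]

lemma rectBd_top (hy : y₁ ≤ y₂) {x : ℝ} (h : x ∈ Set.Icc x₁ x₂) :
    (x + y₂ * Complex.I : ℂ) ∈ rectBd x₁ x₂ y₁ y₂ := by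
  simp [rectBd, h.1, h.2, hy]

lemma rectBd_left (hx : x₁ ≤ x₂) {y : ℝ} (h : y ∈ Set.Icc y₁ y₂) :
    (x₁ + y * Complex.I : ℂ) ∈ rectBd x₁ x₂ y₁ y₂ := by
  simp [rectBd, h.1, h.2, hx]

lemma rectBd_right (hx : x₁ ≤ x₂) {y : ℝ} (h : y ∈ Set.Icc y₁ y₂) :
    (x₂ + y * Complex.I : ℂ) ∈ rectBd x₁ x₂ y₁ y₂ := by
  simp [rectBd, h.1, h.2, hx]

lemma rectInt_congr (hx : x₁ ≤ x₂) (hy : y₁ ≤ y₂) {f g : ℂ → ℂ}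
    (h : ∀ z ∈ rectBd x₁ x₂ y₁ y₂, f z = g z) :
    rectInt f x₁ x₂ y₁ y₂ = rectInt g x₁ x₂ y₁ y₂ := by
  simp only [rectInt]
  congr 1
  · congr 1
    · congr 1 <;> refine intervalIntegral.integral_congr fun x hx' => h _ ?_ <;>
        rw [Set.uIcc_of_le hx] at hx'
      · exact rectBd_bottom hy hx'
      · exact rectBd_top hy hx'
    · congr 1
      refine intervalIntegral.integral_congr fun y hy' => h _ ?_
      rw [Set.uIcc_of_le hy] at hy'
      exact rectBd_right hx hy'
  · congr 1
    refine intervalIntegral.integral_congr fun y hy' => h _ ?_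
    rw [Set.uIcc_of_le hy] at hy'
    exact rectBd_left hx hy'

lemma intervalIntegrable_horizontal {f : ℂ → ℂ} {y : ℝ} (hx : x₁ ≤ x₂)
    (hf : ∀ x : ℝ, x ∈ Set.Icc x₁ x₂ → ContinuousAt f (x + y * Complex.I)) :
    IntervalIntegrable (fun x : ℝ => f (x + y * Complex.I)) volume x₁ x₂ := by
  refine ContinuousOn.intervalIntegrable fun x hx' => ?_
  rw [Set.uIcc_of_le hx] at hx'
  exact (ContinuousAt.comp (f := fun x : ℝ => (x + y * Complex.I : ℂ)) (hf x hx')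
    (by fun_prop)).continuousWithinAt

lemma intervalIntegrable_vertical {f : ℂ → ℂ} {x : ℝ} (hy : y₁ ≤ y₂)
    (hf : ∀ y : ℝ, y ∈ Set.Icc y₁ y₂ → ContinuousAt f (x + y * Complex.I)) :
    IntervalIntegrable (fun y : ℝ => f (x + y * Complex.I)) volume y₁ y₂ := by
  refine ContinuousOn.intervalIntegrable fun y hy' => ?_
  rw [Set.uIcc_of_le hy] at hy'
  exact (ContinuousAt.comp (f := fun y : ℝ => (x + y * Complex.I : ℂ)) (hf y hy')
    (by fun_prop)).continuousWithinAt

lemma rectInt_add (hx : x₁ ≤ x₂) (hy : y₁ ≤ y₂) {f g : ℂ → ℂ}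
    (hf : ∀ z ∈ rectBd x₁ x₂ y₁ y₂, ContinuousAt f z)
    (hg : ∀ z ∈ rectBd x₁ x₂ y₁ y₂, ContinuousAt g z) :
    rectInt (fun z => f z + g z) x₁ x₂ y₁ y₂ =
      rectInt f x₁ x₂ y₁ y₂ + rectInt g x₁ x₂ y₁ y₂ := by
  have key : ∀ {f : ℂ → ℂ}, (∀ z ∈ rectBd x₁ x₂ y₁ y₂, ContinuousAt f z) →
      IntervalIntegrable (fun x : ℝ => f (x + y₁ * Complex.I)) volume x₁ x₂ ∧
      IntervalIntegrable (fun x : ℝ => f (x + y₂ * Complex.I)) volume x₁ x₂ ∧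
      IntervalIntegrable (fun y : ℝ => f (x₁ + y * Complex.I)) volume y₁ y₂ ∧
      IntervalIntegrable (fun y : ℝ => f (x₂ + y * Complex.I)) volume y₁ y₂ := fun hf =>
    ⟨intervalIntegrable_horizontal hx fun x h => hf _ (rectBd_bottom hy h),
      intervalIntegrable_horizontal hx fun x h => hf _ (rectBd_top hy h),
      intervalIntegrable_vertical hy fun y h => hf _ (rectBd_left hx h),
      intervalIntegrable_vertical hy fun y h => hf _ (rectBd_right hx h)⟩
  obtain ⟨f1, f2, f3, f4⟩ := key hf
  obtain ⟨g1, g2, g3, g4⟩ := key hg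
  simp only [rectInt]
  rw [intervalIntegral.integral_add f1 g1, intervalIntegral.integral_add f2 g2,
    intervalIntegral.integral_add f3 g3, intervalIntegral.integral_add f4 g4]
  ring

lemma rectInt_const_mul (c : ℂ) (f : ℂ → ℂ) :
    rectInt (fun z => c * f z) x₁ x₂ y₁ y₂ = c * rectInt f x₁ x₂ y₁ y₂ := by
  simp only [rectInt, intervalIntegral.integral_const_mul]
  ring

lemma rectInt_eq_zero (hx : x₁ ≤ x₂) (hy : y₁ ≤ y₂) {f : ℂ → ℂ}
    (hf : ∀ z : ℂ, z.re ∈ Set.Icc x₁ x₂ → z.im ∈ Set.Icc y₁ y₂ → DifferentiableAt ℂ f z) :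
    rectInt f x₁ x₂ y₁ y₂ = 0 := by
  have := Complex.integral_boundary_rect_eq_zero_of_differentiableOn f ⟨x₁, y₁⟩ ⟨x₂, y₂⟩ (by
    intro z hz
    simp only [Set.uIcc_of_le hx, Set.uIcc_of_le hy, Complex.mem_reProdIm] at hz
    exact (hf z hz.1 hz.2).differentiableWithinAt)
  simpa [rectInt] using this

lemma integral_horizontal {q q' : ℂ → ℂ} {y : ℝ} (hx : x₁ ≤ x₂)
    (hq : ∀ x : ℝ, x ∈ Set.Icc x₁ x₂ →
      HasDerivAt q (q' (x + y * Complex.I)) (x + y * Complex.I))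
    (hc : ∀ x : ℝ, x ∈ Set.Icc x₁ x₂ → ContinuousAt q' (x + y * Complex.I)) :
    ∫ x : ℝ in x₁..x₂, q' (x + y * Complex.I) =
      q (x₂ + y * Complex.I) - q (x₁ + y * Complex.I) := by
  refine intervalIntegral.integral_eq_sub_of_hasDerivAt
    (f := fun x : ℝ => q (x + y * Complex.I)) (fun x h => ?_)
    (intervalIntegrable_horizontal hx hc)
  rw [Set.uIcc_of_le hx] at h
  have h1 : HasDerivAt (fun x : ℝ => (x + y * Complex.I : ℂ)) 1 x :=
    Complex.ofRealCLM.hasDerivAt.add_const _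
  simpa using! (hq x h).comp x h1

lemma integral_vertical {q q' : ℂ → ℂ} {x : ℝ} (hy : y₁ ≤ y₂)
    (hq : ∀ y : ℝ, y ∈ Set.Icc y₁ y₂ →
      HasDerivAt q (q' (x + y * Complex.I)) (x + y * Complex.I))
    (hc : ∀ y : ℝ, y ∈ Set.Icc y₁ y₂ → ContinuousAt q' (x + y * Complex.I)) :
    Complex.I * ∫ y : ℝ in y₁..y₂, q' (x + y * Complex.I) =
      q (x + y₂ * Complex.I) - q (x + y₁ * Complex.I) := by
  rw [← intervalIntegral.integral_const_mul]
  refine intervalIntegral.integral_eq_sub_of_hasDerivAt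
    (f := fun y : ℝ => q (x + y * Complex.I)) (fun y h => ?_)
    ((intervalIntegrable_vertical hy hc).const_mul _)
  rw [Set.uIcc_of_le hy] at h
  have h1 : HasDerivAt (fun y : ℝ => (x + y * Complex.I : ℂ)) Complex.I y := by
    simpa using! (Complex.ofRealCLM.hasDerivAt (x := y)).mul_const Complex.I |>.const_add (x : ℂ)
  simpa [mul_comm] using! (hq y h).comp y h1

lemma rectInt_of_hasDerivAt (hx : x₁ ≤ x₂) (hy : y₁ ≤ y₂) {q q' : ℂ → ℂ}
    (hq : ∀ z ∈ rectBd x₁ x₂ y₁ y₂, HasDerivAt q (q' z) z)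
    (hc : ∀ z ∈ rectBd x₁ x₂ y₁ y₂, ContinuousAt q' z) :
    rectInt q' x₁ x₂ y₁ y₂ = 0 := by
  rw [rectInt,
    integral_horizontal hx (fun x h => hq _ (rectBd_bottom hy h))
      fun x h => hc _ (rectBd_bottom hy h),
    integral_horizontal hx (fun x h => hq _ (rectBd_top hy h)) fun x h => hc _ (rectBd_top hy h),
    integral_vertical hy (fun x h => hq _ (rectBd_left hx h)) fun x h => hc _ (rectBd_left hx h),
    integral_vertical hy (fun x h => hq _ (rectBd_right hx h)) fun x h => hc _ (rectBd_right hx h)]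
  ring

lemma log_sub_log_neg_of_im_pos {z : ℂ} (h : 0 < z.im) :
    Complex.log z - Complex.log (-z) = Real.pi * Complex.I := by
  rw [Complex.log, Complex.log, norm_neg, Complex.arg_neg_eq_arg_sub_pi_of_im_pos h]
  push_cast; ring

lemma log_sub_log_neg_of_im_neg {z : ℂ} (h : z.im < 0) :
    Complex.log z - Complex.log (-z) = -(Real.pi * Complex.I) := by
  rw [Complex.log, Complex.log, norm_neg, Complex.arg_neg_eq_arg_add_pi_of_im_neg h]
  push_cast; ring

/-- On three sides `log(z - z₀)` is a primitive. The left side crosses the branch cut, so `log(-(z -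
z₀))` is used there, and the mismatches at the two left corners add up to `2πi`. -/
lemma rectInt_inv_sub {z₀ : ℂ} (h1 : x₁ < z₀.re) (h2 : z₀.re < x₂) (h3 : y₁ < z₀.im)
    (h4 : z₀.im < y₂) :
    rectInt (fun z => (z - z₀)⁻¹) x₁ x₂ y₁ y₂ = 2 * Real.pi * Complex.I := by
  have hx := (h1.trans h2).le
  have hy := (h3.trans h4).le
  have hd : ∀ z, z - z₀ ∈ Complex.slitPlane →
      HasDerivAt (fun z => Complex.log (z - z₀)) ((z - z₀)⁻¹) z := fun z hz => by
    simpa using! ((hasDerivAt_id z).sub_const z₀).clog hz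
  have hd' : ∀ z, -(z - z₀) ∈ Complex.slitPlane →
      HasDerivAt (fun z => Complex.log (-(z - z₀))) ((z - z₀)⁻¹) z := fun z hz => by
    have hn : HasDerivAt (fun z => -(z - z₀)) (-1) z := ((hasDerivAt_id z).sub_const z₀).neg
    have := hn.clog hz
    rwa [neg_div_neg_eq, one_div] at this
  have hc : ∀ z, z - z₀ ≠ 0 → ContinuousAt (fun z => (z - z₀)⁻¹) z := fun z hz =>
    ContinuousAt.inv₀ (by fun_prop) hz
  have hslit : ∀ {z : ℂ}, z.im ≠ 0 → z ∈ Complex.slitPlane := fun h => Or.inr h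
  have b1 : ∀ x : ℝ, (x + y₁ * Complex.I - z₀ : ℂ).im < 0 := fun x => by simpa using h3
  have b2 : ∀ x : ℝ, 0 < (x + y₂ * Complex.I - z₀ : ℂ).im := fun x => by simpa using h4
  have b3 : ∀ y : ℝ, 0 < (-(x₁ + y * Complex.I - z₀) : ℂ).re := fun x => by simpa using h1
  have b4 : ∀ y : ℝ, 0 < (x₂ + y * Complex.I - z₀ : ℂ).re := fun x => by simpa using h2
  have hne : ∀ {z : ℂ}, z ∈ Complex.slitPlane → z ≠ 0 := fun h => Complex.slitPlane_ne_zero h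
  rw [rectInt,
    integral_horizontal hx (fun x _ => hd _ (hslit (b1 x).ne))
      fun x _ => hc _ (hne (hslit (b1 x).ne)),
    integral_horizontal hx (fun x _ => hd _ (hslit (b2 x).ne'))
      fun x _ => hc _ (hne (hslit (b2 x).ne')),
    integral_vertical hy (fun y _ => hd _ (Or.inl (b4 y))) fun y _ => hc _ (hne (Or.inl (b4 y))),
    integral_vertical hy (fun y _ => hd' _ (Or.inl (b3 y)))
      fun y _ => hc _ (neg_ne_zero.1 (hne (Or.inl (b3 y))))]
  linear_combination log_sub_log_neg_of_im_pos (b2 x₁) - log_sub_log_neg_of_im_neg (b1 x₁)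

/-- Writing `exp z - exp z₀ = (z - z₀) D(z)`, the integrand is the logarithmic derivative `1/(z -
z₀) + D'/D`. Since the height is below `2π`, the rectangle contains no other preimage of `exp z₀`,
so `D` has no zero in it. -/
lemma rectInt_exp_div {z₀ : ℂ} (h1 : x₁ < z₀.re) (h2 : z₀.re < x₂) (h3 : y₁ < z₀.im)
    (h4 : z₀.im < y₂) (h5 : y₂ - y₁ < 2 * Real.pi) :
    rectInt (fun z => Complex.exp z / (Complex.exp z - Complex.exp z₀)) x₁ x₂ y₁ y₂ =
      2 * Real.pi * Complex.I := by
  set E : ℂ → ℂ := fun z => Complex.exp z - Complex.exp z₀ with hE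
  have hEd : Differentiable ℂ E := by fun_prop
  set D := dslope E z₀ with hDdef
  have hD : Differentiable ℂ D := by
    rw [← differentiableOn_univ, hDdef, Complex.differentiableOn_dslope univ_mem]
    exact hEd.differentiableOn
  have hED : ∀ z, E z = (z - z₀) * D z := fun z => by
    have := sub_smul_dslope E z₀ z
    simp only [smul_eq_mul] at this
    rw [hDdef, this]; simp [hE]
  have hderiv : ∀ z, Complex.exp z = D z + (z - z₀) * deriv D z := by
    intro z
    have d1 : HasDerivAt E (Complex.exp z) z := (Complex.hasDerivAt_exp z).sub_const _
    have d2 : HasDerivAt E (1 * D z + (z - z₀) * deriv D z) z := by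
      rw [show E = fun z => (z - z₀) * D z from funext hED]
      exact ((hasDerivAt_id z).sub_const z₀).mul (hD z).hasDerivAt
    rw [d1.unique d2, one_mul]
  have hD0 : ∀ z : ℂ, z.im ∈ Set.Icc y₁ y₂ → D z ≠ 0 := by
    intro z hz h0
    have hEz : Complex.exp z = Complex.exp z₀ := by
      rw [← sub_eq_zero]; simpa [h0] using hED z
    obtain ⟨n, hn⟩ := Complex.exp_eq_exp_iff_exists_int.1 hEz
    have him := congrArg Complex.im hn
    simp at him
    have hn0 : n = 0 := by
      have hpi := Real.pi_pos
      have a1 : (n : ℝ) < 1 := by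
        by_contra! h
        nlinarith [hz.1, hz.2]
      have a2 : (-1 : ℝ) < n := by
        by_contra! h
        nlinarith [hz.1, hz.2]
      have a1' : n < 1 := by exact_mod_cast a1
      have a2' : -1 < n := by exact_mod_cast a2
      omega
    have hzz : z = z₀ := by simpa [hn0] using hn
    have := hderiv z₀
    rw [sub_self, zero_mul, add_zero, ← hzz, h0] at this
    exact Complex.exp_ne_zero _ this
  have hx := (h1.trans h2).le
  have hy := (h3.trans h4).le
  have hne : ∀ z ∈ rectBd x₁ x₂ y₁ y₂, z - z₀ ≠ 0 := by
    rintro z ⟨-, -, h⟩ h0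
    rw [sub_eq_zero.1 h0] at h
    rcases h with h | h | h | h <;> linarith
  have hD' : Differentiable ℂ (deriv D) := fun z =>
    ((hD.analyticAt z).deriv).differentiableAt
  rw [rectInt_congr hx hy (g := fun z => (z - z₀)⁻¹ + deriv D z / D z) fun z hz => ?_,
    rectInt_add hx hy, rectInt_inv_sub h1 h2 h3 h4, rectInt_eq_zero hx hy, add_zero]
  · exact fun z _ hz => (hD' z).div (hD z) (hD0 z hz)
  · exact fun z hz => ContinuousAt.inv₀ (by fun_prop) (hne z hz)
  · exact fun z hz => (hD' z).continuousAt.div (hD z).continuousAt (hD0 z hz.2.1)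
  · have a := hne z hz
    have b := hD0 z hz.2.1
    change Complex.exp z / E z = _
    rw [hED, hderiv]
    field_simp

/-- The residue theorem for a polar rectangle, in logarithmic coordinates. -/
theorem rectInt_eq_sum_residue (hx : x₁ ≤ x₂) (hy : y₁ ≤ y₂) (h5 : y₂ - y₁ < 2 * Real.pi)
    (S : Finset ℂ) (ρ : ℂ → ℂ) : ∀ g : ℂ → ℂ,
    (∀ u ∈ S, ∃ z, Complex.exp z = u ∧ x₁ < z.re ∧ z.re < x₂ ∧ y₁ < z.im ∧ z.im < y₂) →
    (∀ z : ℂ, z.re ∈ Set.Icc x₁ x₂ → z.im ∈ Set.Icc y₁ y₂ → Complex.exp z ∉ S →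
      DifferentiableAt ℂ g (Complex.exp z)) →
    (∀ u ∈ S, HasResidue g u (ρ u)) →
    (∀ z ∈ rectBd x₁ x₂ y₁ y₂, Complex.exp z ∉ S) →
    rectInt (fun z => g (Complex.exp z) * Complex.exp z) x₁ x₂ y₁ y₂ =
      2 * Real.pi * Complex.I * ∑ u ∈ S, ρ u := by
  classical
  induction S using Finset.induction_on with
  | empty =>
    intro g _ hg _ _
    rw [Finset.sum_empty, mul_zero]
    refine rectInt_eq_zero hx hy fun z h1 h2 => ?_
    have := hg z h1 h2 (Finset.notMem_empty _)
    exact (this.comp z Complex.differentiable_exp.differentiableAt).mul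
      Complex.differentiable_exp.differentiableAt
  | insert u₀ S hu₀ ih =>
    intro g hin hg hres hbd
    obtain ⟨q, h, hq, hh, heq⟩ := hres u₀ (Finset.mem_insert_self _ _)
    set c := ρ u₀
    have hqa : ∀ u, u ≠ u₀ → AnalyticAt ℂ (deriv q) u := fun u hu =>
      (hq.analyticAt (isOpen_compl_singleton.mem_nhds hu)).deriv
    have hca : ∀ u, u ≠ u₀ → AnalyticAt ℂ (fun u => c / (u - u₀)) u := fun u hu =>
      analyticAt_const.div (by fun_prop) (sub_ne_zero.2 hu)
    -- Removing the singular part at `u₀` and filling in the value there gives a function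
    -- holomorphic near `u₀` with unchanged residues at the points of `S`, to which the induction
    -- hypothesis applies.
    set g₁ : ℂ → ℂ := fun u => if u = u₀ then h u₀ else g u - (c / (u - u₀) + deriv q u) with hg₁
    have hg₁u₀ : g₁ =ᶠ[𝓝 u₀] h := by
      rw [eventually_nhdsWithin_iff] at heq
      filter_upwards [heq] with u hu
      by_cases h0 : u = u₀
      · simp [hg₁, h0]
      · simp only [hg₁, h0, if_false]
        rw [hu h0]; ring
    have hg₁u : ∀ u, u ≠ u₀ → g₁ =ᶠ[𝓝 u] fun u => g u - (c / (u - u₀) + deriv q u) := by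
      intro u hu
      filter_upwards [isOpen_compl_singleton.mem_nhds hu] with v hv
      have : v ≠ u₀ := hv
      simp [hg₁, this]
    have hne : ∀ z ∈ rectBd x₁ x₂ y₁ y₂, Complex.exp z ≠ u₀ := fun z hz h' =>
      hbd z hz (h' ▸ Finset.mem_insert_self _ _)
    have hdiff : ∀ z : ℂ, z.re ∈ Set.Icc x₁ x₂ → z.im ∈ Set.Icc y₁ y₂ → Complex.exp z ∉ S →
        DifferentiableAt ℂ g₁ (Complex.exp z) := by
      intro z hz1 hz2 hz3
      by_cases h0 : Complex.exp z = u₀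
      · rw [h0]
        exact hh.differentiableAt.congr_of_eventuallyEq hg₁u₀
      · refine DifferentiableAt.congr_of_eventuallyEq ?_ (hg₁u _ h0)
        exact (hg z hz1 hz2 (by simp [h0, hz3])).sub
          ((hca _ h0).differentiableAt.add (hqa _ h0).differentiableAt)
    have hih := ih g₁ (fun u hu => hin u (Finset.mem_insert_of_mem hu)) hdiff (by
        intro u hu
        have hu0 : u ≠ u₀ := fun h' => hu₀ (h' ▸ hu)
        obtain ⟨q', h', hq', hh', heq'⟩ := hres u (Finset.mem_insert_of_mem hu)
        refine ⟨q', fun u => h' u - (c / (u - u₀) + deriv q u), hq',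
          hh'.sub ((hca u hu0).add (hqa u hu0)), ?_⟩
        filter_upwards [heq', (hg₁u u hu0).filter_mono nhdsWithin_le_nhds] with v h1 h2
        rw [h2, h1]; ring)
      fun z hz h' => hbd z hz (Finset.mem_insert_of_mem h')
    obtain ⟨z₀, hz₀, i1, i2, i3, i4⟩ := hin u₀ (Finset.mem_insert_self _ _)
    have hexpc : ∀ z, ContinuousAt Complex.exp z := fun z => Complex.continuous_exp.continuousAt
    have hsub : ∀ z ∈ rectBd x₁ x₂ y₁ y₂, Complex.exp z - u₀ ≠ 0 := fun z hz =>
      sub_ne_zero.2 (hne z hz)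
    have k1 : ∀ z ∈ rectBd x₁ x₂ y₁ y₂, ContinuousAt
        (fun z => c * (Complex.exp z / (Complex.exp z - u₀))) z := fun z hz =>
      continuousAt_const.mul ((hexpc z).div ((hexpc z).sub continuousAt_const) (hsub z hz))
    have k2 : ∀ z ∈ rectBd x₁ x₂ y₁ y₂, ContinuousAt
        (fun z => deriv q (Complex.exp z) * Complex.exp z) z := fun z hz =>
      (ContinuousAt.comp (hqa _ (hne z hz)).continuousAt (hexpc z)).mul (hexpc z)
    have k3 : ∀ z ∈ rectBd x₁ x₂ y₁ y₂, ContinuousAt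
        (fun z => g₁ (Complex.exp z) * Complex.exp z) z := fun z hz =>
      (ContinuousAt.comp (hdiff z hz.1 hz.2.1
        fun h' => hbd z hz (Finset.mem_insert_of_mem h')).continuousAt (hexpc z)).mul (hexpc z)
    have e2 : rectInt (fun z => deriv q (Complex.exp z) * Complex.exp z) x₁ x₂ y₁ y₂ = 0 :=
      rectInt_of_hasDerivAt hx hy (q := fun z => q (Complex.exp z)) (fun z hz =>
        (hq.differentiableAt (isOpen_compl_singleton.mem_nhds (hne z hz))).hasDerivAt.comp z
          (Complex.hasDerivAt_exp z)) k2
    have e1 : rectInt (fun z => Complex.exp z / (Complex.exp z - u₀)) x₁ x₂ y₁ y₂ =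
        2 * Real.pi * Complex.I := by
      rw [← hz₀]; exact rectInt_exp_div i1 i2 i3 i4 h5
    rw [rectInt_congr hx hy (g := fun z => (c * (Complex.exp z / (Complex.exp z - u₀)) +
        deriv q (Complex.exp z) * Complex.exp z) + g₁ (Complex.exp z) * Complex.exp z)
        (fun z hz => by
          simp only [hg₁, hne z hz, if_false]
          ring),
      rectInt_add hx hy (f := fun z => c * (Complex.exp z / (Complex.exp z - u₀)) +
        deriv q (Complex.exp z) * Complex.exp z) (fun z hz => (k1 z hz).add (k2 z hz)) k3, rectInt_add hx hy k1 k2, e2,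
      rectInt_const_mul, e1, hih, Finset.sum_insert hu₀]
    ring

end Rect

/-! ### Integrals along rays and arcs -/

/-- The integrand `f(u) u^{s-1} du` on the ray of argument `φ`. -/
noncomputable def rayIntegrand (f : ℂ → ℂ) (φ : ℝ) (s : ℂ) (x : ℝ) : ℂ :=
  f (x * Complex.exp (Complex.I * φ)) * branchPow x φ s * Complex.exp (Complex.I * φ)

/-- The integrand `f(u) u^{s-1} du` on the circle of radius `r`. -/
noncomputable def arcIntegrand (f : ℂ → ℂ) (r : ℝ) (s : ℂ) (t : ℝ) : ℂ :=
  f (r * Complex.exp (Complex.I * t)) * branchPow r t s *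
    (Complex.I * r * Complex.exp (Complex.I * t))

/-- The integral of `f(u) u^{s-1}` along the ray of argument `φ` from radius `r` to infinity. -/
noncomputable def ray (f : ℂ → ℂ) (r φ : ℝ) (s : ℂ) : ℂ := ∫ x in Set.Ioi r, rayIntegrand f φ s x

/-- The integral of `f(u) u^{s-1}` along the arc of radius `r` from argument `φ₁` to `φ₂`. -/
noncomputable def arc (f : ℂ → ℂ) (r φ₁ φ₂ : ℝ) (s : ℂ) : ℂ := ∫ t in φ₁..φ₂, arcIntegrand f r s t

/-- The integral of `f(u) u^{s-1}` along a Hankel contour that starts with argument `φ`. -/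
noncomputable def tiltedHankel (f : ℂ → ℂ) (r φ : ℝ) (s : ℂ) : ℂ :=
  -ray f r φ s + arc f r φ (φ + 2 * Real.pi) s + ray f r (φ + 2 * Real.pi) s

lemma branchPow_eq_cpow {x : ℝ} (hx : 0 < x) (φ : ℝ) (s : ℂ) :
    branchPow x φ s = Complex.exp ((s - 1) * (Complex.I * φ)) * (x : ℂ) ^ (s - 1) := by
  rw [branchPow, Complex.cpow_def_of_ne_zero (by exact_mod_cast hx.ne'), ← Complex.exp_add,
    Complex.ofReal_log hx.le]
  ring_nf

lemma exp_I_mul_add_two_pi (φ : ℝ) :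
    Complex.exp (Complex.I * (φ + 2 * Real.pi : ℝ)) = Complex.exp (Complex.I * φ) := by
  push_cast
  rw [mul_add, Complex.exp_add, mul_comm Complex.I (2 * Real.pi), Complex.exp_two_pi_mul_I, mul_one]

lemma branchPow_add_two_pi (x φ : ℝ) (s : ℂ) :
    branchPow x (φ + 2 * Real.pi) s = e s * branchPow x φ s := by
  have h : e s = Complex.exp (2 * Real.pi * Complex.I * (s - 1)) := by
    rw [mul_sub, Complex.exp_sub, mul_one, Complex.exp_two_pi_mul_I, div_one, e]
  rw [branchPow, branchPow, h, ← Complex.exp_add]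
  push_cast
  ring_nf

lemma rayIntegrand_add_two_pi (f : ℂ → ℂ) (φ : ℝ) (s : ℂ) (x : ℝ) :
    rayIntegrand f (φ + 2 * Real.pi) s x = e s * rayIntegrand f φ s x := by
  rw [rayIntegrand, rayIntegrand, exp_I_mul_add_two_pi, branchPow_add_two_pi]; ring

lemma arcIntegrand_add_two_pi (f : ℂ → ℂ) (r : ℝ) (s : ℂ) (t : ℝ) :
    arcIntegrand f r s (t + 2 * Real.pi) = e s * arcIntegrand f r s t := by
  rw [arcIntegrand, arcIntegrand, exp_I_mul_add_two_pi, branchPow_add_two_pi]; ring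

lemma ray_add_two_pi (f : ℂ → ℂ) (r φ : ℝ) (s : ℂ) :
    ray f r (φ + 2 * Real.pi) s = e s * ray f r φ s := by
  simp only [ray, rayIntegrand_add_two_pi, integral_const_mul]

lemma arc_add_two_pi (f : ℂ → ℂ) (r φ₁ φ₂ : ℝ) (s : ℂ) :
    arc f r (φ₁ + 2 * Real.pi) (φ₂ + 2 * Real.pi) s = e s * arc f r φ₁ φ₂ s := by
  simp only [arc]
  rw [← intervalIntegral.integral_comp_add_right]
  simp only [arcIntegrand_add_two_pi, intervalIntegral.integral_const_mul]

lemma tiltedHankel_eq (f : ℂ → ℂ) (r φ : ℝ) (s : ℂ) :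
    tiltedHankel f r φ s = (e s - 1) * ray f r φ s + arc f r φ (φ + 2 * Real.pi) s := by
  rw [tiltedHankel, ray_add_two_pi]; ring

lemma continuous_arcIntegrand {f : ℂ → ℂ} {r : ℝ}
    (hf : ∀ t : ℝ, ContinuousAt f (r * Complex.exp (Complex.I * t))) (s : ℂ) :
    Continuous (arcIntegrand f r s) := by
  have h1 : Continuous fun t : ℝ => f (r * Complex.exp (Complex.I * t)) :=
    continuous_iff_continuousAt.2 fun t =>
      ContinuousAt.comp (f := fun t : ℝ => (r * Complex.exp (Complex.I * t) : ℂ)) (hf t)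
        (by fun_prop)
  unfold arcIntegrand branchPow
  exact (h1.mul (by fun_prop)).mul (by fun_prop)

/-- Tilting adds an arc at the far end of the circle and removes one at its start. The added arc is
the removed one continued by a full turn, hence `e(s)` times it; the rays behave likewise. -/
lemma tiltedHankel_sub {f : ℂ → ℂ} {r : ℝ}
    (hf : ∀ t : ℝ, ContinuousAt f (r * Complex.exp (Complex.I * t))) (φ₁ φ₂ : ℝ) (s : ℂ) :
    tiltedHankel f r φ₂ s - tiltedHankel f r φ₁ s =
      (e s - 1) * (ray f r φ₂ s + arc f r φ₁ φ₂ s - ray f r φ₁ s) := by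
  have hi : ∀ a b, IntervalIntegrable (arcIntegrand f r s) volume a b := fun a b =>
    (continuous_arcIntegrand hf s).intervalIntegrable a b
  have h : arc f r φ₂ (φ₂ + 2 * Real.pi) s - arc f r φ₁ (φ₁ + 2 * Real.pi) s =
      e s * arc f r φ₁ φ₂ s - arc f r φ₁ φ₂ s := by
    rw [← arc_add_two_pi]
    exact intervalIntegral.integral_interval_sub_interval_comm' (hi _ _) (hi _ _) (hi _ _)
  rw [tiltedHankel_eq, tiltedHankel_eq]
  linear_combination h

/-! ### Contour deformation in a polar rectangle -/

/-- Under `u = e^z` the form `u^{s-1} du` becomes `e^{sz} dz`. It is single-valued in `z`, so the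
range of arguments is unrestricted. -/
lemma rectInt_polar (f : ℂ → ℂ) (s : ℂ) {r R : ℝ} (hr : 0 < r) (hR : r ≤ R) (φ₁ φ₂ : ℝ) :
    rectInt (fun z => f (Complex.exp z) * Complex.exp (s * z)) (Real.log r) (Real.log R) φ₁ φ₂ =
      (∫ x in r..R, rayIntegrand f φ₁ s x) - (∫ x in r..R, rayIntegrand f φ₂ s x) +
        arc f R φ₁ φ₂ s - arc f r φ₁ φ₂ s := by
  have hexp : ∀ {x : ℝ}, 0 < x → ∀ φ : ℝ, Complex.exp ((Real.log x : ℝ) + φ * Complex.I) =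
      x * Complex.exp (Complex.I * φ) := by
    intro x hx φ
    rw [Complex.exp_add, ← Complex.ofReal_exp, Real.exp_log hx, mul_comm (φ : ℂ)]
  have hpow : ∀ {x : ℝ}, 0 < x → ∀ φ : ℝ,
      Complex.exp (s * ((Real.log x : ℝ) + φ * Complex.I)) =
      branchPow x φ s * (x * Complex.exp (Complex.I * φ)) := by
    intro x hx φ
    rw [← hexp hx, branchPow, ← Complex.exp_add]
    ring_nf
  have harc : ∀ {x : ℝ}, 0 < x → Complex.I * ∫ y in φ₁..φ₂,
      f (Complex.exp ((Real.log x : ℝ) + y * Complex.I)) *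
        Complex.exp (s * ((Real.log x : ℝ) + y * Complex.I)) = arc f x φ₁ φ₂ s := by
    intro x hx
    rw [← intervalIntegral.integral_const_mul, arc]
    refine intervalIntegral.integral_congr fun t _ => ?_
    simp only [arcIntegrand]
    rw [hexp hx, hpow hx]
    ring
  have hray : ∀ φ : ℝ, ∫ x in Real.log r..Real.log R,
      f (Complex.exp (x + φ * Complex.I)) * Complex.exp (s * (x + φ * Complex.I)) =
        ∫ x in r..R, rayIntegrand f φ s x := by
    intro φ
    have hpos : ∀ x ∈ Set.uIcc r R, 0 < x := fun x hx => by
      rw [Set.uIcc_of_le hR] at hx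
      exact hr.trans_le hx.1
    rw [← intervalIntegral.integral_deriv_smul_comp_of_deriv_nonneg (f := Real.log)
      (f' := fun x => x⁻¹)
      (g := fun x : ℝ => f (Complex.exp (x + φ * Complex.I)) *
        Complex.exp (s * (x + φ * Complex.I)))
      (fun x hx => (Real.continuousAt_log (hpos x hx).ne').continuousWithinAt)
      (fun x hx => Real.hasDerivAt_log (hpos x (Set.Ioo_subset_Icc_self hx)).ne')
      (fun x hx => (inv_pos.2 (hpos x (Set.Ioo_subset_Icc_self hx))).le)]
    refine intervalIntegral.integral_congr fun x hx => ?_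
    have hx0 := hpos x hx
    have hx' : (x : ℂ) ≠ 0 := by exact_mod_cast hx0.ne'
    simp only [Function.comp, rayIntegrand, Complex.real_smul]
    rw [hexp hx0, hpow hx0]
    push_cast
    field_simp
  rw [rectInt, hray, hray, harc (hr.trans_le hR), harc hr]

lemma exp_eq_polar (z : ℂ) :
    Complex.exp z = (Real.exp z.re : ℝ) * Complex.exp (Complex.I * z.im) := by
  rw [Complex.ofReal_exp, ← Complex.exp_add, mul_comm Complex.I, Complex.re_add_im]

lemma exp_re_mem {r R : ℝ} (hr : 0 < r) (hR : r ≤ R) {x : ℝ}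
    (hx : x ∈ Set.Icc (Real.log r) (Real.log R)) : Real.exp x ∈ Set.Icc r R :=
  ⟨(Real.log_le_iff_le_exp hr).1 hx.1, (Real.le_log_iff_exp_le (hr.trans_le hR)).1 hx.2⟩

lemma polar_cauchy {f : ℂ → ℂ} (s : ℂ) {r R : ℝ} (hr : 0 < r) (hR : r ≤ R) {φ₁ φ₂ : ℝ}
    (hφ : φ₁ ≤ φ₂) (hf : ∀ x ∈ Set.Icc r R, ∀ t ∈ Set.Icc φ₁ φ₂,
      DifferentiableAt ℂ f (x * Complex.exp (Complex.I * t))) :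
    (∫ x in r..R, rayIntegrand f φ₁ s x) - (∫ x in r..R, rayIntegrand f φ₂ s x) +
        arc f R φ₁ φ₂ s - arc f r φ₁ φ₂ s = 0 := by
  rw [← rectInt_polar f s hr hR]
  refine rectInt_eq_zero (Real.log_le_log hr hR) hφ fun z h1 h2 => ?_
  have := hf _ (exp_re_mem hr hR h1) _ h2
  rw [← exp_eq_polar] at this
  exact (this.comp z Complex.differentiable_exp.differentiableAt).mul (by fun_prop)

/-- The residues are taken with the principal branch of `u^{s-1}`. It agrees with the branch in
logarithmic coordinates only for arguments strictly between `-π` and `π`. -/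
lemma polar_residue {f : ℂ → ℂ} (s : ℂ) {r R : ℝ} (hr : 0 < r) (hR : r ≤ R) {φ₁ φ₂ : ℝ}
    (hφ : φ₁ ≤ φ₂) (hφ₁ : -Real.pi < φ₁) (hφ₂ : φ₂ < Real.pi) (S : Finset ℂ)
    (hS : ∀ u ∈ S, r < ‖u‖ ∧ ‖u‖ < R ∧ φ₁ < u.arg ∧ u.arg < φ₂)
    (hf : ∀ x ∈ Set.Icc r R, ∀ t ∈ Set.Icc φ₁ φ₂, (x * Complex.exp (Complex.I * t) : ℂ) ∉ S →
      DifferentiableAt ℂ f (x * Complex.exp (Complex.I * t)))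
    (hm : ∀ u ∈ S, MeromorphicAt f u) :
    (∫ x in r..R, rayIntegrand f φ₁ s x) - (∫ x in r..R, rayIntegrand f φ₂ s x) +
        arc f R φ₁ φ₂ s - arc f r φ₁ φ₂ s =
      2 * Real.pi * Complex.I * ∑ u ∈ S, residue (fun u => f u * u ^ (s - 1)) u := by
  have hx := Real.log_le_log hr hR
  have hlog : ∀ z : ℂ, z.im ∈ Set.Icc φ₁ φ₂ → Complex.log (Complex.exp z) = z := fun z hz =>
    Complex.log_exp (by linarith [hz.1]) (by linarith [hz.2])
  have hcpow : ∀ u : ℂ, φ₁ ≤ u.arg → u.arg ≤ φ₂ → u ≠ 0 →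
      AnalyticAt ℂ (fun u : ℂ => u ^ (s - 1)) u := fun u h1 h2 h0 =>
    AnalyticAt.cpow (f := fun u : ℂ => u) analyticAt_id analyticAt_const
      (Complex.mem_slitPlane_iff_arg.2 ⟨by linarith, h0⟩)
  have hnorm : ∀ z : ℂ, ‖Complex.exp z‖ = Real.exp z.re := Complex.norm_exp
  have harg : ∀ z : ℂ, z.im ∈ Set.Icc φ₁ φ₂ → (Complex.exp z).arg = z.im := fun z hz => by
    rw [← Complex.log_im, hlog z hz]
  have hbd : ∀ z ∈ rectBd (Real.log r) (Real.log R) φ₁ φ₂, Complex.exp z ∉ S := by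
    rintro z ⟨-, h2, h3⟩ hz
    obtain ⟨a1, a2, a3, a4⟩ := hS _ hz
    rw [hnorm] at a1 a2
    rw [harg z h2] at a3 a4
    rcases h3 with h | h | h | h
    · rw [h, Real.exp_log hr] at a1; exact lt_irrefl _ a1
    · rw [h, Real.exp_log (hr.trans_le hR)] at a2; exact lt_irrefl _ a2
    · rw [h] at a3; exact lt_irrefl _ a3
    · rw [h] at a4; exact lt_irrefl _ a4
  have hne : ∀ u ∈ S, u ≠ 0 := fun u hu => norm_pos_iff.1 (hr.trans (hS u hu).1)
  rw [← rectInt_polar f s hr hR, rectInt_congr hx hφ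
    (g := fun z => (f (Complex.exp z) * Complex.exp z ^ (s - 1)) * Complex.exp z)]
  · refine rectInt_eq_sum_residue (g := fun u => f u * u ^ (s - 1)) hx hφ (by linarith) S _
      (fun u hu => ?_) (fun z h1 h2 h3 => ?_) (fun u hu => ?_) hbd
    · obtain ⟨a1, a2, a3, a4⟩ := hS u hu
      refine ⟨Complex.log u, Complex.exp_log (hne u hu), ?_, ?_, ?_, ?_⟩
      · rw [Complex.log_re]; exact Real.log_lt_log hr a1
      · rw [Complex.log_re]; exact Real.log_lt_log (hr.trans a1) a2
      · rwa [Complex.log_im]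
      · rwa [Complex.log_im]
    · have := hf _ (exp_re_mem hr hR h1) _ h2
      rw [← exp_eq_polar] at this
      exact (this h3).mul (hcpow _ (by rw [harg z h2]; exact h2.1) (by rw [harg z h2]; exact h2.2)
        (Complex.exp_ne_zero _)).differentiableAt
    · obtain ⟨a1, a2, a3, a4⟩ := hS u hu
      exact hasResidue_of_meromorphicAt
        ((hm u hu).mul (hcpow u a3.le a4.le (hne u hu)).meromorphicAt)
  · intro z hz
    rw [mul_assoc, Complex.cpow_def_of_ne_zero (Complex.exp_ne_zero _), hlog z hz.2.1,
      ← Complex.exp_add]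
    ring_nf

/-! ### Convergence and holomorphy in `s` -/

lemma rayIntegrand_eq (f : ℂ → ℂ) (φ : ℝ) (s : ℂ) {x : ℝ} (hx : 0 < x) :
    rayIntegrand f φ s x = Complex.exp (s * (Complex.I * φ)) *
      ((x : ℂ) ^ (s - 1) * f (x * Complex.exp (Complex.I * φ))) := by
  rw [rayIntegrand, branchPow_eq_cpow hx, show s * (Complex.I * φ) =
    (s - 1) * (Complex.I * φ) + Complex.I * φ by ring, Complex.exp_add]
  ring

section Decay

variable {f : ℂ → ℂ} {r φ C κ : ℝ} (hr : 0 < r) (hκ : 0 < κ)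
  (hf : ∀ x ≥ r, ContinuousAt f (x * Complex.exp (Complex.I * φ)))
  (hbd : ∀ x ≥ r, ‖f (x * Complex.exp (Complex.I * φ))‖ ≤ C * Real.exp (-(x * κ)))

/-- Seen as a Mellin transform of a function that vanishes near `0` and decays exponentially, the
ray integral converges and is holomorphic for every `s`. -/
lemma mellin_indicator_eq (f : ℂ → ℂ) {r : ℝ} (hr : 0 < r) (φ : ℝ) (s : ℂ) :
    ray f r φ s = Complex.exp (s * (Complex.I * φ)) *
      mellin ((Set.Ioi r).indicator fun x : ℝ => f (x * Complex.exp (Complex.I * φ))) s := by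
  rw [ray, mellin, ← integral_const_mul]
  have : ∀ x : ℝ, Complex.exp (s * (Complex.I * φ)) * ((x : ℂ) ^ (s - 1) •
      (Set.Ioi r).indicator (fun x : ℝ => f (x * Complex.exp (Complex.I * φ))) x) =
      (Set.Ioi r).indicator (fun x : ℝ => Complex.exp (s * (Complex.I * φ)) *
        ((x : ℂ) ^ (s - 1) * f (x * Complex.exp (Complex.I * φ)))) x := by
    intro x
    by_cases hx : x ∈ Set.Ioi r <;> simp [hx]
  simp only [this]
  rw [setIntegral_indicator measurableSet_Ioi, Set.Ioi_inter_Ioi, max_eq_right hr.le]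
  exact setIntegral_congr_fun measurableSet_Ioi fun x hx => rayIntegrand_eq f φ s (hr.trans hx)

include hr hκ hf hbd

lemma mellin_indicator (s : ℂ) :
    MellinConvergent ((Set.Ioi r).indicator fun x : ℝ => f (x * Complex.exp (Complex.I * φ))) s ∧
    DifferentiableAt ℂ
      (mellin ((Set.Ioi r).indicator fun x : ℝ => f (x * Complex.exp (Complex.I * φ)))) s := by
  set k : ℝ → ℂ := fun x => f (x * Complex.exp (Complex.I * φ))
  have hk : ContinuousOn k (Set.Ici r) := fun x hx =>
    (ContinuousAt.comp (f := fun x : ℝ => (x * Complex.exp (Complex.I * φ) : ℂ)) (hf x hx)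
      (by fun_prop)).continuousWithinAt
  have hO : k =O[atTop] fun x => Real.exp (-κ * x) := by
    refine Asymptotics.IsBigO.of_bound C ?_
    filter_upwards [eventually_ge_atTop r] with x hx
    rw [Real.norm_of_nonneg (Real.exp_pos _).le, neg_mul, mul_comm κ]
    exact hbd x hx
  have hint : IntegrableOn k (Set.Ioi r) := by
    have hm := (hk.mono Set.Ioi_subset_Ici_self).aestronglyMeasurable measurableSet_Ioi
      (μ := volume)
    exact (integrable_norm_iff hm).1 (integrable_of_isBigO_exp_neg hκ hk.norm hO.norm_left)
  have h1 : LocallyIntegrableOn ((Set.Ioi r).indicator k) (Set.Ioi 0) :=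
    ((integrable_indicator_iff measurableSet_Ioi).2 hint).locallyIntegrable.locallyIntegrableOn _
  have h2 : (Set.Ioi r).indicator k =O[atTop] fun x => Real.exp (-κ * x) := by
    refine hO.congr' ?_ EventuallyEq.rfl
    filter_upwards [eventually_gt_atTop r] with x hx
    rw [Set.indicator_of_mem (Set.mem_Ioi.2 hx)]
  have h3 : (Set.Ioi r).indicator k =O[𝓝[>] 0] (· ^ (-(s.re - 1)) : ℝ → ℝ) := by
    refine (Asymptotics.isBigO_zero _ _).congr' ?_ EventuallyEq.rfl
    filter_upwards [Ioo_mem_nhdsGT hr] with x hx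
    rw [Set.indicator_of_notMem (Set.notMem_Ioi.2 hx.2.le)]
  exact ⟨mellinConvergent_of_isBigO_rpow_exp hκ h1 h2 h3 (by linarith),
    mellin_differentiableAt_of_isBigO_rpow_exp hκ h1 h2 h3 (by linarith)⟩

lemma integrableOn_rayIntegrand (s : ℂ) : IntegrableOn (rayIntegrand f φ s) (Set.Ioi r) := by
  have h := (mellin_indicator hr hκ hf hbd s).1
  rw [MellinConvergent] at h
  have h2 := (h.mono_set (Set.Ioi_subset_Ioi hr.le)).const_mul
    (Complex.exp (s * (Complex.I * φ)))
  refine IntegrableOn.congr_fun h2 (fun x hx => ?_) measurableSet_Ioi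
  simp only [Set.indicator_of_mem hx, smul_eq_mul]
  exact (rayIntegrand_eq f φ s (hr.trans hx)).symm

lemma differentiable_ray : Differentiable ℂ (ray f r φ) := by
  intro s
  rw [show ray f r φ = _ from funext (mellin_indicator_eq f hr φ)]
  exact DifferentiableAt.mul (by fun_prop) (mellin_indicator hr hκ hf hbd s).2

end Decay

lemma differentiable_arc {f : ℂ → ℂ} {r : ℝ}
    (hf : ∀ t : ℝ, ContinuousAt f (r * Complex.exp (Complex.I * t))) (φ₁ φ₂ : ℝ) :
    Differentiable ℂ (arc f r φ₁ φ₂) := by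
  intro s₀
  have h1 : Continuous fun t : ℝ => f (r * Complex.exp (Complex.I * t)) :=
    continuous_iff_continuousAt.2 fun t =>
      ContinuousAt.comp (f := fun t : ℝ => (r * Complex.exp (Complex.I * t) : ℂ)) (hf t)
        (by fun_prop)
  set ℓ : ℝ → ℂ := fun t => Real.log r + Complex.I * t with hℓ
  have hℓc : Continuous ℓ := by fun_prop
  set k : ℝ → ℂ := fun t => f (r * Complex.exp (Complex.I * t)) *
    (Complex.I * r * Complex.exp (Complex.I * t)) with hk
  have hkc : Continuous k := h1.mul (by fun_prop)
  have hF : ∀ s t, arcIntegrand f r s t = k t * Complex.exp ((s - 1) * ℓ t) := fun s t => by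
    simp only [arcIntegrand, branchPow, hk, hℓ]; ring
  have := intervalIntegral.hasDerivAt_integral_of_dominated_loc_of_deriv_le (μ := volume)
    (a := φ₁) (b := φ₂)
    (F := fun s t => arcIntegrand f r s t)
    (F' := fun s t => k t * (Complex.exp ((s - 1) * ℓ t) * ℓ t)) (x₀ := s₀)
    -- On the unit ball around `s₀` one has `‖s - 1‖ ≤ ‖s₀‖ + 2`.
    (bound := fun t => ‖k t‖ * (Real.exp ((‖s₀‖ + 2) * ‖ℓ t‖) * ‖ℓ t‖))
    (Metric.ball_mem_nhds s₀ one_pos)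
    (Eventually.of_forall fun s => (continuous_arcIntegrand hf s).aestronglyMeasurable)
    ((continuous_arcIntegrand hf s₀).intervalIntegrable _ _)
    (Continuous.aestronglyMeasurable (by fun_prop))
    (Eventually.of_forall fun t _ s hs => by
      rw [norm_mul (k t), norm_mul (Complex.exp _)]
      refine mul_le_mul_of_nonneg_left (mul_le_mul_of_nonneg_right ?_ (norm_nonneg _))
        (norm_nonneg _)
      refine (Complex.norm_exp_le_exp_norm _).trans (Real.exp_le_exp.2 ?_)
      rw [norm_mul]
      gcongr
      have h2 : ‖s - s₀‖ < 1 := by rwa [← mem_ball_iff_norm]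
      calc ‖s - 1‖ = ‖s₀ + (s - s₀) - 1‖ := by congr 1; ring
        _ ≤ ‖s₀‖ + ‖s - s₀‖ + ‖(1 : ℂ)‖ :=
          (norm_sub_le _ _).trans (by gcongr; exact norm_add_le _ _)
        _ ≤ ‖s₀‖ + 2 := by rw [norm_one]; linarith)
    (Continuous.intervalIntegrable (by fun_prop) _ _)
    (Eventually.of_forall fun t _ s _ => by
      simp only [hF]
      have h3 : HasDerivAt (fun s : ℂ => (s - 1) * ℓ t) (ℓ t) s := by
        simpa using! ((hasDerivAt_id s).sub_const 1).mul_const (ℓ t)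
      exact h3.cexp.const_mul (k t))
  exact this.2.differentiableAt

/-! ### The Hankel integral as a tilted Hankel integral -/

/-- Used with `τ = 0` and `τ = 2π`: both ends of the Hankel contour lie over the same ray and differ
only in the branch of the power. -/
lemma integral_ray_eq {N : ℕ} {δ : Param N} {f : ℂ → ℂ} {C : ℂ} {ρ φ τ r : ℝ} (hρ : 0 < ρ)
    (hr : 0 < r) (hτ : Complex.exp (Complex.I * τ) = 1)
    (hF : ∀ u, F u δ = C * f (ρ * Complex.exp (Complex.I * φ) * u)) (s : ℂ) :
    ∫ x in Set.Ioi r, F (x : ℂ) δ * branchPow x τ s =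
      C * Complex.exp (-s * (Real.log ρ + Complex.I * φ)) * ray f (ρ * r) (φ + τ) s := by
  have hφτ : Complex.exp (Complex.I * (φ + τ : ℝ)) = Complex.exp (Complex.I * φ) := by
    push_cast
    rw [mul_add, Complex.exp_add, hτ, mul_one]
  rw [ray, ← integral_comp_mul_left_Ioi' _ _ hρ, ← integral_smul, ← integral_const_mul]
  refine setIntegral_congr_fun measurableSet_Ioi fun x hx => ?_
  have hx0 : 0 < x := hr.trans hx
  have hexp : Complex.exp (-s * (Real.log ρ + Complex.I * φ)) * (ρ * (branchPow (ρ * x) (φ + τ) s *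
      Complex.exp (Complex.I * φ))) = branchPow x τ s := by
    have h1 : (ρ : ℂ) = Complex.exp (Real.log ρ) := by
      rw [← Complex.ofReal_exp, Real.exp_log hρ]
    have h2 : branchPow x τ s = branchPow x τ s * Complex.exp (Complex.I * τ) := by
      rw [hτ, mul_one]
    rw [h2, branchPow, branchPow, Real.log_mul hρ.ne' hx0.ne']
    rw [h1]
    rw [← hφτ]
    simp only [← Complex.exp_add]
    push_cast
    ring_nf
  simp only [rayIntegrand, Complex.real_smul]
  rw [hF, hφτ, ← hexp]
  push_cast
  ring_nf

lemma hankel_eq_tiltedHankel {N : ℕ} {δ : Param N} {f : ℂ → ℂ} {C : ℂ} {ρ φ r : ℝ} (hρ : 0 < ρ)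
    (hr : 0 < r) (hF : ∀ u, F u δ = C * f (ρ * Complex.exp (Complex.I * φ) * u)) (s : ℂ) :
    hankel r s δ = C * Complex.exp (-s * (Real.log ρ + Complex.I * φ)) *
      tiltedHankel f (ρ * r) φ s := by
  have harc : ∫ t in (0 : ℝ)..(2 * Real.pi), F (r * Complex.exp (Complex.I * t)) δ *
      branchPow r t s * (Complex.I * r * Complex.exp (Complex.I * t)) =
      C * Complex.exp (-s * (Real.log ρ + Complex.I * φ)) *
        arc f (ρ * r) φ (φ + 2 * Real.pi) s := by
    have := intervalIntegral.integral_comp_add_right (a := 0) (b := 2 * Real.pi)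
      (arcIntegrand f (ρ * r) s) φ
    rw [zero_add, add_comm (2 * Real.pi)] at this
    rw [arc, ← this, ← intervalIntegral.integral_const_mul]
    refine intervalIntegral.integral_congr fun t _ => ?_
    have hexp : Complex.exp (-s * (Real.log ρ + Complex.I * φ)) *
        (branchPow (ρ * r) (t + φ) s * (ρ * Complex.exp (Complex.I * (t + φ : ℝ)))) =
        branchPow r t s * Complex.exp (Complex.I * t) := by
      have h1 : (ρ : ℂ) = Complex.exp (Real.log ρ) := by
        rw [← Complex.ofReal_exp, Real.exp_log hρ]
      rw [branchPow, branchPow, Real.log_mul hρ.ne' hr.ne']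
      rw [h1]
      simp only [← Complex.exp_add]
      push_cast
      ring_nf
    simp only [arcIntegrand]
    have harg : (ρ : ℂ) * Complex.exp (Complex.I * φ) * (r * Complex.exp (Complex.I * t)) =
        ((ρ * r : ℝ) : ℂ) * Complex.exp (Complex.I * (t + φ : ℝ)) := by
      push_cast
      rw [mul_add, Complex.exp_add]
      ring
    rw [hF, harg]
    push_cast at hexp ⊢
    linear_combination (-(C * f (ρ * r * Complex.exp (Complex.I * (t + φ))) * Complex.I * r)) * hexp
  rw [hankel, harc, integral_ray_eq hρ hr (by simp) hF,
    integral_ray_eq hρ hr (by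
      push_cast; rw [mul_comm]; exact Complex.exp_two_pi_mul_I) hF, add_zero, tiltedHankel]
  ring

/-! ### Arcs of large radius -/

lemma integrable_exp_neg_abs : Integrable fun x : ℝ => Real.exp (-|x|) := by
  refine (integrable_inv_one_add_sq.const_mul 2).mono' (by fun_prop)
    (Eventually.of_forall fun x => ?_)
  rw [Real.norm_of_nonneg (Real.exp_pos _).le, Real.exp_neg, ← div_eq_mul_inv,
    inv_eq_one_div, div_le_div_iff₀ (Real.exp_pos _) (by positivity)]
  have := Real.quadratic_le_exp_of_nonneg (abs_nonneg x)
  nlinarith [sq_abs x, abs_nonneg x]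

lemma lintegral_exp_neg_abs_le {κ : ℝ} (hκ : 0 < κ) (t₀ : ℝ) : ∃ K : ℝ, 0 ≤ K ∧ ∀ R > 0,
    ∫⁻ t : ℝ, ENNReal.ofReal (Real.exp (-(R * (κ * |t - t₀|)))) ≤ ENNReal.ofReal (K / R) := by
  refine ⟨(∫ x : ℝ, Real.exp (-|x|)) / κ,
    div_nonneg (integral_nonneg fun x => (Real.exp_pos _).le) hκ.le, fun R hR => ?_⟩
  have hpos : 0 < R * κ := mul_pos hR hκ
  have heq : ∀ t : ℝ, R * (κ * |t - t₀|) = |(R * κ) * (t - t₀)| := fun t => by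
    rw [abs_mul, abs_of_pos hpos, mul_assoc]
  simp only [heq]
  have hint : Integrable fun t : ℝ => Real.exp (-|(R * κ) * (t - t₀)|) :=
    (integrable_exp_neg_abs.comp_mul_left' hpos.ne').comp_sub_right t₀
  rw [← ofReal_integral_eq_lintegral_ofReal hint
    (Eventually.of_forall fun t => (Real.exp_pos _).le)]
  refine ENNReal.ofReal_le_ofReal (le_of_eq ?_)
  rw [integral_sub_right_eq_self (fun t => Real.exp (-|(R * κ) * t|)) t₀,
    Measure.integral_comp_mul_left (fun x => Real.exp (-|x|)), abs_of_pos (inv_pos.2 hpos),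
    smul_eq_mul]
  field_simp

/-- Locally the decay rate exceeds `κ|t - t₀|`, and scaling shows that `∫ e^{-Rκ|t - t₀|} dt` is a
constant over `R`. Compactness of the interval makes the constant global. -/
lemma integral_exp_decayRate_le {N : ℕ} {δ : Param N} (hδ : δ ∈ starD N) {φ₁ φ₂ : ℝ}
    (hφ : φ₁ ≤ φ₂) : ∃ K : ℝ, 0 ≤ K ∧ ∀ R > 0,
      ∫ t in φ₁..φ₂, Real.exp (-(R * decayRate δ t)) ≤ K / R := by
  -- The lower integral is monotone and subadditive in the domain of integration for arbitrary sets,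
  -- as the induction over compact sets requires.
  have key : ∃ K : ℝ, 0 ≤ K ∧ ∀ R > 0, ∫⁻ t in Set.Icc φ₁ φ₂,
      ENNReal.ofReal (Real.exp (-(R * decayRate δ t))) ≤ ENNReal.ofReal (K / R) := by
    refine isCompact_Icc.induction_on (p := fun S => ∃ K : ℝ, 0 ≤ K ∧ ∀ R > 0, ∫⁻ t in S,
      ENNReal.ofReal (Real.exp (-(R * decayRate δ t))) ≤ ENNReal.ofReal (K / R))
      ⟨0, le_rfl, by simp⟩ ?_ ?_ ?_
    · rintro s t hst ⟨K, hK, h⟩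
      exact ⟨K, hK, fun R hR => (lintegral_mono_set hst).trans (h R hR)⟩
    · rintro s t ⟨K₁, hK₁, h₁⟩ ⟨K₂, hK₂, h₂⟩
      refine ⟨K₁ + K₂, add_nonneg hK₁ hK₂, fun R hR => (lintegral_union_le _ _ _).trans ?_⟩
      rw [add_div, ENNReal.ofReal_add (by positivity) (by positivity)]
      exact add_le_add (h₁ R hR) (h₂ R hR)
    · intro t₀ _
      obtain ⟨κ, hκ, h⟩ := exists_mul_abs_le_decayRate hδ t₀
      obtain ⟨η, hη, hball⟩ := Metric.eventually_nhds_iff_ball.1 h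
      obtain ⟨K, hK, hK'⟩ := lintegral_exp_neg_abs_le hκ t₀
      refine ⟨Metric.ball t₀ η, mem_nhdsWithin_of_mem_nhds (Metric.ball_mem_nhds t₀ hη), K, hK,
        fun R hR => le_trans ?_ (hK' R hR)⟩
      refine (setLIntegral_mono' Metric.isOpen_ball.measurableSet fun t ht => ?_).trans
        (setLIntegral_le_lintegral _ _)
      refine ENNReal.ofReal_le_ofReal (Real.exp_le_exp.2 (neg_le_neg ?_))
      exact mul_le_mul_of_nonneg_left (hball t ht) hR.le
  obtain ⟨K, hK, h⟩ := key
  refine ⟨K, hK, fun R hR => ?_⟩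
  have hc : Continuous fun t => Real.exp (-(R * decayRate δ t)) := by
    have := continuous_decayRate δ
    fun_prop
  have := h R hR
  rw [← ofReal_integral_eq_lintegral_ofReal (hc.continuousOn.integrableOn_compact isCompact_Icc)
    (Eventually.of_forall fun t => (Real.exp_pos _).le),
    ENNReal.ofReal_le_ofReal_iff (by positivity)] at this
  rwa [intervalIntegral.integral_of_le hφ, ← integral_Icc_eq_integral_Ioc]

lemma norm_branchPow {R : ℝ} (hR : 0 < R) (t : ℝ) (s : ℂ) :
    ‖branchPow R t s‖ = R ^ (s.re - 1) * Real.exp (-(s.im * t)) := by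
  rw [branchPow, Complex.norm_exp, Real.rpow_def_of_pos hR, ← Real.exp_add]
  simp
  ring

lemma tendsto_farRadii {N : ℕ} {δ : Param N} {f : ℝ → ℂ} {l : Filter ℂ}
    (h : ∀ c > 0, Tendsto f (atTop ⊓ 𝓟 {r | ∀ u ∈ poles δ, c ≤ |‖u‖ - r|}) l) :
    Tendsto f (farRadii δ) l := by
  simp only [farRadii, tendsto_iSup]
  exact h

lemma eventually_farRadii {N : ℕ} {δ : Param N} {p : ℝ → Prop}
    (h : ∀ c > 0, ∀ᶠ r in atTop, (∀ u ∈ poles δ, c ≤ |‖u‖ - r|) → p r) :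
    ∀ᶠ r in farRadii δ, p r := by
  simp only [farRadii, eventually_iSup]
  exact fun c hc => eventually_inf_principal.2 (h c hc)

/-- The power and the arc length contribute `R^{Re s}`, the integrated decay of `F` contributes
`1/R`, and `Re s < 1` makes the product tend to `0`. -/
lemma tendsto_arc_farRadii {N : ℕ} {δ : Param N} (hδ : δ ∈ starD N) {φ₁ φ₂ : ℝ} (hφ : φ₁ ≤ φ₂)
    {s : ℂ} (hs : s.re < 1) :
    Tendsto (fun R => arc (fun u => F u δ) R φ₁ φ₂ s) (farRadii δ) (𝓝 0) := by
  refine tendsto_farRadii fun c hc => ?_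
  obtain ⟨C, hC, hF⟩ := norm_F_circle_le hδ.1 hc
  obtain ⟨K, hK, hKR⟩ := integral_exp_decayRate_le hδ hφ
  set B := Real.exp (|s.im| * max |φ₁| |φ₂|)
  have hlim : Tendsto (fun R : ℝ => C * B * K * R ^ (-(1 - s.re))) atTop (𝓝 0) := by
    simpa using (tendsto_rpow_neg_atTop (sub_pos.2 hs)).const_mul (C * B * K)
  refine squeeze_zero_norm' ?_ (hlim.mono_left inf_le_left)
  rw [eventually_inf_principal]
  filter_upwards [eventually_ge_atTop 1] with R hR hp
  have hR0 : 0 < R := by linarith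
  have hc : Continuous fun t => Real.exp (-(R * decayRate δ t)) := by
    have := continuous_decayRate δ
    fun_prop
  have h1 : ‖arc (fun u => F u δ) R φ₁ φ₂ s‖ ≤
      ∫ t in φ₁..φ₂, C * B * R ^ s.re * Real.exp (-(R * decayRate δ t)) := by
    refine intervalIntegral.norm_integral_le_of_norm_le hφ (Eventually.of_forall fun t ht => ?_)
      ((hc.const_mul _).intervalIntegrable _ _)
    rw [arcIntegrand, norm_mul, norm_mul, norm_branchPow hR0]
    have e1 : ‖Complex.I * R * Complex.exp (Complex.I * t)‖ = R := by
      simp [Complex.norm_exp, abs_of_pos hR0]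
    have e2 : Real.exp (-(s.im * t)) ≤ B := by
      refine Real.exp_le_exp.2 ((neg_le_abs _).trans ?_)
      rw [abs_mul]
      gcongr
      exact abs_le_max_abs_abs ht.1.le ht.2
    have e3 : R ^ (s.re - 1) * R = R ^ s.re := by
      rw [← Real.rpow_add_one hR0.ne']; ring_nf
    rw [e1]
    calc _ ≤ (C * Real.exp (-(R * decayRate δ t))) * (R ^ (s.re - 1) * B) * R := by
          gcongr
          exact hF R hR hp t
      _ = _ := by rw [← e3]; ring
  refine h1.trans ?_
  rw [intervalIntegral.integral_const_mul]
  have h2 : R ^ s.re * (K / R) = K * R ^ (-(1 - s.re)) := by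
    rw [neg_sub, Real.rpow_sub_one hR0.ne']; ring
  calc _ ≤ C * B * R ^ s.re * (K / R) := by gcongr; exact hKR R hR0
    _ = _ := by linear_combination (C * B) * h2

/-! ### Sums of residues over sectors -/

section Regular

variable {N : ℕ} {δ : Param N}

lemma continuousAt_F_ray (hδ : δ ∈ bigD N) {φ : ℝ} (hφ : IsRegularAngle δ φ) {x : ℝ} (hx : 0 < x) :
    ContinuousAt (fun u => F u δ) (x * Complex.exp (Complex.I * φ)) :=
  (differentiableAt_F (mul_ne_zero (by exact_mod_cast hx.ne') (Complex.exp_ne_zero _))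
    (notMem_poles_of_isRegularAngle hδ hφ x)).continuousAt

lemma norm_polar {x : ℝ} (hx : 0 < x) (t : ℝ) : ‖(x * Complex.exp (Complex.I * t) : ℂ)‖ = x := by
  simp [Complex.norm_exp, abs_of_pos hx]

lemma arg_polar {x t : ℝ} (hx : 0 < x) (ht : t ∈ Set.Ioc (-Real.pi) Real.pi) :
    (x * Complex.exp (Complex.I * t) : ℂ).arg = t := by
  rw [mul_comm Complex.I, Complex.exp_mul_I, Complex.arg_mul_cos_add_sin_mul_I hx ht]

lemma differentiableAt_F_circle {r : ℝ} (hr : 0 < r) (hp : ∀ u ∈ poles δ, ‖u‖ ≠ r) (t : ℝ) :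
    DifferentiableAt ℂ (fun u => F u δ) (r * Complex.exp (Complex.I * t)) :=
  differentiableAt_F (mul_ne_zero (by exact_mod_cast hr.ne') (Complex.exp_ne_zero _))
    fun h => hp _ h (norm_polar hr t)

lemma ray_convergence (hδ : δ ∈ bigD N) {φ : ℝ} (hφ : IsRegularAngle δ φ) {r : ℝ} (hr : 0 < r) :
    (∀ s, IntegrableOn (rayIntegrand (fun u => F u δ) φ s) (Set.Ioi r)) ∧
      Differentiable ℂ (ray (fun u => F u δ) r φ) := by
  obtain ⟨C, -, hC⟩ := norm_F_ray_le hφ hr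
  have hc : ∀ x ≥ r, ContinuousAt (fun u => F u δ) (x * Complex.exp (Complex.I * φ)) :=
    fun x hx => continuousAt_F_ray hδ hφ (hr.trans_le hx)
  exact ⟨fun s => integrableOn_rayIntegrand hr hφ.1 hc hC s, differentiable_ray hr hφ.1 hc hC⟩

/-- The residue theorem on `r < |u| < R`, `φ₁ < arg u < φ₂`: the outer arc vanishes in the limit and
the truncated rays converge. -/
theorem tendsto_residue_sum (hδ : δ ∈ starD N) {φ₁ φ₂ r : ℝ} (hφ : φ₁ ≤ φ₂)
    (h1 : -Real.pi < φ₁) (h2 : φ₂ < Real.pi) (hr1 : IsRegularAngle δ φ₁)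
    (hr2 : IsRegularAngle δ φ₂) (hr : 0 < r) (hp : ∀ u ∈ poles δ, r < ‖u‖) {s : ℂ}
    (hs : s.re < 1) :
    Tendsto (fun R => ∑ᶠ u ∈ {u | u ∈ poles δ ∧ φ₁ < u.arg ∧ u.arg < φ₂ ∧ ‖u‖ < R},
      residue (fun u => F u δ * u ^ (s - 1)) u) (farRadii δ)
      (𝓝 ((2 * Real.pi * Complex.I)⁻¹ * (ray (fun u => F u δ) r φ₁ s -
        ray (fun u => F u δ) r φ₂ s - arc (fun u => F u δ) r φ₁ φ₂ s))) := by
  classical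
  have htop : Tendsto (fun R : ℝ => R) (farRadii δ) atTop := by
    simp only [farRadii, tendsto_iSup]
    exact fun c _ => tendsto_id.mono_left inf_le_left
  have hray : ∀ φ, IsRegularAngle δ φ → Tendsto (fun R => ∫ x in r..R,
      rayIntegrand (fun u => F u δ) φ s x) (farRadii δ) (𝓝 (ray (fun u => F u δ) r φ s)) :=
    fun φ h => (intervalIntegral_tendsto_integral_Ioi r ((ray_convergence hδ.1 h hr).1 s)
      tendsto_id).comp htop
  have hlim := (((hray φ₁ hr1).sub (hray φ₂ hr2)).add
    (tendsto_arc_farRadii hδ hφ hs)).sub_const (arc (fun u => F u δ) r φ₁ φ₂ s)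
  rw [add_zero] at hlim
  refine (hlim.const_mul (2 * Real.pi * Complex.I)⁻¹).congr' ?_
  refine eventually_farRadii fun c hc => ?_
  filter_upwards [eventually_gt_atTop r] with R hR hfar
  have hfin : {u | u ∈ poles δ ∧ φ₁ < u.arg ∧ u.arg < φ₂ ∧ ‖u‖ < R}.Finite :=
    (finite_poles_lt hδ.1 R).subset fun u hu => ⟨hu.1, hu.2.2.2⟩
  refine Eq.trans ?_ (finsum_mem_eq_finite_toFinset_sum _ hfin).symm
  rw [polar_residue s hr hR.le hφ h1 h2 hfin.toFinset,
    inv_mul_cancel_left₀ two_pi_I_ne_zero]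
  · intro u hu
    have hu' := hfin.mem_toFinset.1 hu
    exact ⟨hp u hu'.1, hu'.2.2.2, hu'.2.1, hu'.2.2.1⟩
  · intro x hx t ht hnot
    have hx0 := hr.trans_le hx.1
    refine differentiableAt_F (mul_ne_zero (by exact_mod_cast hx0.ne') (Complex.exp_ne_zero _))
      fun hpole => hnot (hfin.mem_toFinset.2 ⟨hpole, ?_⟩)
    rw [arg_polar hx0 ⟨by linarith [ht.1], by linarith [ht.2]⟩, norm_polar hx0]
    -- No pole lies on the boundary: the two rays are regular, and the outer circle keeps distance
    -- `c` from the poles.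
    refine ⟨lt_of_le_of_ne ht.1 ?_, lt_of_le_of_ne ht.2 ?_, lt_of_le_of_ne hx.2 ?_⟩
    · rintro rfl
      exact notMem_poles_of_isRegularAngle hδ.1 hr1 x hpole
    · rintro rfl
      exact notMem_poles_of_isRegularAngle hδ.1 hr2 x hpole
    · rintro rfl
      have := hfar _ hpole
      rw [norm_polar hx0, sub_self, abs_zero] at this
      exact absurd this (not_le.2 hc)
  · exact fun u _ => meromorphicAt_F δ u

/-- Cauchy's theorem on a full turn of the annulus. The two radial sides lie over the same segment
and combine with the factor `1 - e(s)`. -/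
lemma tiltedHankel_radius (hδ : δ ∈ bigD N) {φ r R : ℝ} (hφ : IsRegularAngle δ φ) (hr : 0 < r)
    (hR : 0 < R) (hpr : ∀ u ∈ poles δ, r < ‖u‖) (hpR : ∀ u ∈ poles δ, R < ‖u‖) (s : ℂ) :
    tiltedHankel (fun u => F u δ) r φ s = tiltedHankel (fun u => F u δ) R φ s := by
  wlog hrR : r ≤ R generalizing r R
  · exact (this hR hr hpR hpr (le_of_not_ge hrR)).symm
  have h1 := polar_cauchy (f := fun u => F u δ) s hr hrR
    (show φ ≤ φ + 2 * Real.pi by linarith [Real.pi_pos]) (fun x hx t _ =>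
      differentiableAt_F_circle (hr.trans_le hx.1)
        (fun u hu h => absurd (hpR u hu) (not_lt.2 (h ▸ hx.2))) t)
  have hint := (ray_convergence hδ hφ hr).1 s
  have hray : ray (fun u => F u δ) r φ s = (∫ x in r..R, rayIntegrand (fun u => F u δ) φ s x) +
      ray (fun u => F u δ) R φ s :=
    (intervalIntegral.integral_interval_add_Ioi hint
      (hint.mono_set (Set.Ioi_subset_Ioi hrR))).symm
  simp only [rayIntegrand_add_two_pi, intervalIntegral.integral_const_mul] at h1
  rw [tiltedHankel_eq, tiltedHankel_eq, hray]
  linear_combination -h1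

lemma differentiable_tiltedHankel (hδ : δ ∈ bigD N) {φ r : ℝ} (hφ : IsRegularAngle δ φ)
    (hr : 0 < r) (hp : ∀ u ∈ poles δ, r < ‖u‖) :
    Differentiable ℂ (tiltedHankel (fun u => F u δ) r φ) := by
  have h1 := (ray_convergence hδ hφ hr).2
  have h2 := differentiable_arc (f := fun u => F u δ)
    (fun t => (differentiableAt_F_circle hr (fun u hu => (hp u hu).ne') t).continuousAt) φ
    (φ + 2 * Real.pi)
  have h3 : Differentiable ℂ e := by unfold e; fun_prop
  rw [show tiltedHankel (fun u => F u δ) r φ = _ from funext (tiltedHankel_eq _ r φ)]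
  fun_prop

/-- Regular directions carry no poles, so the residue sums over the sector are empty and their limit
is `0`. The condition `Re s < 1` is needed for the arcs at infinity. -/
lemma tiltedHankel_angle (hδ : δ ∈ starD N) {φ₁ φ₂ r : ℝ} (hφ : φ₁ ≤ φ₂)
    (h1 : -Real.pi < φ₁) (h2 : φ₂ < Real.pi) (hreg : ∀ t ∈ Set.Icc φ₁ φ₂, IsRegularAngle δ t)
    (hr : 0 < r) (hp : ∀ u ∈ poles δ, r < ‖u‖) {s : ℂ} (hs : s.re < 1) :
    tiltedHankel (fun u => F u δ) r φ₁ s = tiltedHankel (fun u => F u δ) r φ₂ s := by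
  have := farRadii_neBot hδ.1
  have hlim := tendsto_residue_sum hδ hφ h1 h2 (hreg _ ⟨le_rfl, hφ⟩) (hreg _ ⟨hφ, le_rfl⟩) hr hp hs
  have hempty : ∀ R, {u | u ∈ poles δ ∧ φ₁ < u.arg ∧ u.arg < φ₂ ∧ ‖u‖ < R} = ∅ := by
    intro R
    refine Set.eq_empty_iff_forall_notMem.2 fun u hu => ?_
    refine notMem_poles_of_isRegularAngle hδ.1 (hreg u.arg ⟨hu.2.1.le, hu.2.2.1.le⟩) ‖u‖ ?_
    rw [mul_comm Complex.I, Complex.norm_mul_exp_arg_mul_I]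
    exact hu.1
  simp only [hempty, Set.mem_empty_iff_false, finsum_false, finsum_zero] at hlim
  have h0 := tendsto_nhds_unique hlim tendsto_const_nhds
  rw [mul_eq_zero, inv_eq_zero] at h0
  have h3 := h0.resolve_left two_pi_I_ne_zero
  have h4 := tiltedHankel_sub (f := fun u => F u δ)
    (fun t => (differentiableAt_F_circle hr (fun u hu => (hp u hu).ne') t).continuousAt) φ₁ φ₂ s
  linear_combination -h4 + (e s - 1) * h3

end Regular

/-! ### The normalizing factor -/

/-- The function `1 / (Γ(s) (e(s) - 1))` with its removable singularities removed. -/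
noncomputable def gammaFactor (s : ℂ) : ℂ :=
  Complex.Gamma (1 - s) * Complex.exp (-(Real.pi * Complex.I * s)) / (2 * Real.pi * Complex.I)

/-- The reflection formula, combined with `e(s) - 1 = 2i e^{πis} sin(πs)`. -/
lemma inv_Gamma_mul_e_sub_one {s : ℂ} (hs : e s ≠ 1) :
    (Complex.Gamma s * (e s - 1))⁻¹ = gammaFactor s := by
  have hπ : (Real.pi : ℂ) ≠ 0 := by exact_mod_cast Real.pi_ne_zero
  have h1 : e s - 1 = Complex.exp (Real.pi * Complex.I * s) *
      (2 * Complex.I * Complex.sin (Real.pi * s)) := by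
    have hI : 2 * Complex.I * Complex.sin (Real.pi * s) =
        Complex.exp (Real.pi * Complex.I * s) - Complex.exp (-(Real.pi * Complex.I * s)) := by
      rw [Complex.sin, show -(Real.pi * s : ℂ) * Complex.I = -(Real.pi * Complex.I * s) by ring,
        show (Real.pi * s : ℂ) * Complex.I = Real.pi * Complex.I * s by ring]
      linear_combination (Complex.exp (-(Real.pi * Complex.I * s)) -
        Complex.exp (Real.pi * Complex.I * s)) * Complex.I_mul_I
    rw [hI, mul_sub, ← Complex.exp_add, ← Complex.exp_add, add_neg_cancel, Complex.exp_zero, e]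
    ring_nf
  have hsin : Complex.sin (Real.pi * s) ≠ 0 := by
    intro h
    rw [h, mul_zero, mul_zero, sub_eq_zero] at h1
    exact hs h1
  have h2 := Complex.Gamma_mul_Gamma_one_sub s
  rw [eq_div_iff hsin] at h2
  refine inv_eq_of_mul_eq_one_right ?_
  have h3 : Complex.exp (Real.pi * Complex.I * s) * Complex.exp (-(Real.pi * Complex.I * s)) = 1 := by
    rw [← Complex.exp_add, add_neg_cancel, Complex.exp_zero]
  rw [gammaFactor, h1, mul_div_assoc', div_eq_one_iff_eq two_pi_I_ne_zero]
  linear_combination 2 * Complex.I * h2 + 2 * Complex.I * Complex.Gamma s * Complex.Gamma (1 - s) *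
    Complex.sin (Real.pi * s) * h3

lemma differentiableAt_gammaFactor {s : ℂ} (hs : s.re < 1) : DifferentiableAt ℂ gammaFactor s := by
  have h : DifferentiableAt ℂ (fun s => Complex.Gamma (1 - s)) s := by
    refine DifferentiableAt.comp (g := Complex.Gamma) (f := fun s : ℂ => 1 - s) s
      (Complex.differentiableAt_Gamma _ fun m hm => ?_) (by fun_prop)
    have := congrArg Complex.re hm
    simp at this
    linarith [(Nat.cast_nonneg m : (0 : ℝ) ≤ m)]
  unfold gammaFactor
  fun_prop

/-- The factor `2πi` is the derivative of `e(s) - 1` at `s = -k`; this product is the coefficient of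
`ρ` in the formula for the derivative. -/
lemma gammaFactor_neg_nat (k : ℕ) :
    gammaFactor (-(k : ℂ)) * (2 * Real.pi * Complex.I) = (-1) ^ k * (k.factorial : ℂ) := by
  have h : Complex.exp (-(Real.pi * Complex.I * -(k : ℂ))) = (-1) ^ k := by
    rw [show -(Real.pi * Complex.I * -(k : ℂ)) = k * (Real.pi * Complex.I) by ring,
      Complex.exp_nat_mul, Complex.exp_pi_mul_I]
  rw [gammaFactor, div_mul_cancel₀ _ two_pi_I_ne_zero, h, sub_neg_eq_add, add_comm (1 : ℂ),
    Complex.Gamma_nat_eq_factorial]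
  ring

lemma hasDerivAt_e (s : ℂ) : HasDerivAt e (2 * Real.pi * Complex.I * e s) s := by
  have h : HasDerivAt (fun z : ℂ => 2 * Real.pi * Complex.I * z) (2 * Real.pi * Complex.I) s := by
    simpa using! (hasDerivAt_id s).const_mul (2 * Real.pi * Complex.I : ℂ)
  rw [mul_comm]
  exact h.cexp

lemma e_neg_nat (k : ℕ) : e (-(k : ℂ)) = 1 := by
  rw [e, show 2 * Real.pi * Complex.I * -(k : ℂ) = ((-k : ℤ) : ℂ) * (2 * Real.pi * Complex.I) by
    push_cast; ring]
  exact Complex.exp_int_mul_two_pi_mul_I _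

lemma tendsto_Lraw {N : ℕ} {ε : Param N → ℝ} {δ : Param N} {s : ℂ} (hs : s.re < 1)
    {H : ℂ → ℂ} (hH : ContinuousAt H s)
    (h : ∀ z : ℂ, z.re < 1 → hankel (ε δ) z δ = H z) :
    Tendsto (fun z => Lraw ε z δ) (𝓝[≠] s) (𝓝 (gammaFactor s * H s)) := by
  -- The derivative of `e` never vanishes, so even when `e s = 1` the value `1` is not taken again
  -- near `s`.
  have h1 : ∀ᶠ z in 𝓝[≠] s, e z ≠ 1 :=
    (hasDerivAt_e s).eventually_ne (mul_ne_zero two_pi_I_ne_zero (e_ne_zero s))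
  have h2 : ∀ᶠ z : ℂ in 𝓝[≠] s, z.re < 1 :=
    (Complex.continuous_re.continuousAt.eventually_lt_const hs).filter_mono nhdsWithin_le_nhds
  refine Tendsto.congr' ?_ (((differentiableAt_gammaFactor hs).continuousAt.mul hH).tendsto.mono_left
    nhdsWithin_le_nhds)
  filter_upwards [h1, h2] with z hz1 hz2
  rw [Lraw, h z hz2, div_eq_mul_inv, inv_Gamma_mul_e_sub_one hz1, Pi.mul_apply, mul_comm]

/-! ### Evaluation of `ℒ_N` -/

section Eval

variable {N : ℕ} {ε : Param N → ℝ} {δ : Param N} (hε : ε ∈ admissible N) (hδ : δ ∈ starD N)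

include hε hδ

lemma exists_radius : ∃ r > 0, ∀ u ∈ poles δ, r < ‖u‖ := by
  obtain ⟨h0, h⟩ := hε δ hδ.1
  refine ⟨ε δ, h0, fun u hu => ?_⟩
  obtain ⟨hu0, l, hl⟩ := mem_poles.1 hu
  by_contra! hle
  exact h l u (norm_pos_iff.2 hu0) hle hl

variable (Λ : Finset (Fin N)) (σ : Equiv.Perm (Fin N)) {α : ℂ} (hα : α ≠ 0)

include hα

lemma integrableOn_G {φ : ℝ} (hφ : IsRegularAngle δ φ) {ρ : ℝ} (hρ : 0 < ρ)
    (hαφ : α = ρ * Complex.exp (Complex.I * φ)) (z : ℂ) :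
    IntegrableOn (fun x : ℝ => F (x : ℂ) (G Λ σ α δ) * branchPow x 0 z)
      (Set.Ioi (ε (G Λ σ α δ))) := by
  have hr := (hε _ (G_mem_bigD Λ σ hα hδ.1)).1
  set r := ε (G Λ σ α δ)
  have hmul : ∀ x : ℝ, α * x = (ρ * x : ℝ) * Complex.exp (Complex.I * φ) := fun x => by
    rw [hαφ]; push_cast; ring
  obtain ⟨C, hC, hb⟩ := norm_F_ray_le hφ (mul_pos hρ hr)
  set c : ℂ := (-1) ^ Λ.card * e ((∑ l ∈ Λ.image (fun j => σ⁻¹ j), δ.2.2 l : ℝ) : ℂ)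
  have := integrableOn_rayIntegrand (f := fun u => F u (G Λ σ α δ)) (φ := 0) (C := ‖c‖ * C)
    (κ := ρ * decayRate δ φ) hr (mul_pos hρ hφ.1) (fun x hx => ?_) (fun x hx => ?_) z
  · have heq : rayIntegrand (fun u => F u (G Λ σ α δ)) 0 z =
        fun x : ℝ => F (x : ℂ) (G Λ σ α δ) * branchPow x 0 z := by
      ext x; simp [rayIntegrand]
    rwa [heq] at this
  · have hx0 : 0 < x := hr.trans_le hx
    refine (differentiableAt_F ?_ ?_).continuousAt
    · simpa using hx0.ne'
    · rw [mem_poles_G Λ σ hα]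
      simp only [Complex.ofReal_zero, mul_zero, Complex.exp_zero, mul_one]
      rw [hmul]
      exact notMem_poles_of_isRegularAngle hδ.1 hφ _
  · simp only [Complex.ofReal_zero, mul_zero, Complex.exp_zero, mul_one]
    rw [F_G, hmul, norm_mul, mul_assoc]
    gcongr
    refine (hb _ (by gcongr)).trans (le_of_eq ?_)
    ring_nf

/-- In the variable `αu` the circle has radius `ρ ε(gδ)`, which by admissibility is smaller than the
modulus of every pole of `F(·, δ)`. The contour can then be moved to a radius and an angle that
depend neither on `ε(gδ)` nor on `φ`. -/
lemma hankel_G {φ₀ φ r : ℝ} (hφ₀ : -Real.pi < φ₀) (hle : φ₀ ≤ φ) (hφπ : φ < Real.pi)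
    (hreg : ∀ t ∈ Set.Icc φ₀ φ, IsRegularAngle δ t) (hr : 0 < r)
    (hp : ∀ u ∈ poles δ, r < ‖u‖) {ρ : ℝ} (hρ : 0 < ρ)
    (hαφ : α = ρ * Complex.exp (Complex.I * φ)) {z : ℂ} (hz : z.re < 1) :
    hankel (ε (G Λ σ α δ)) z (G Λ σ α δ) =
      (-1) ^ Λ.card * e ((∑ l ∈ Λ.image (fun j => σ⁻¹ j), δ.2.2 l : ℝ) : ℂ) *
        Complex.exp (-z * (Real.log ρ + Complex.I * φ)) *
        tiltedHankel (fun u => F u δ) r φ₀ z := by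
  obtain ⟨hr', hadm⟩ := hε _ (G_mem_bigD Λ σ hα hδ.1)
  have hnα : ‖α‖ = ρ := by rw [hαφ, norm_polar hρ]
  have hp' : ∀ u ∈ poles δ, ρ * ε (G Λ σ α δ) < ‖u‖ := by
    intro u hu
    have h1 : α⁻¹ * u ∈ poles (G Λ σ α δ) := by
      rwa [mem_poles_G Λ σ hα, mul_inv_cancel_left₀ hα]
    obtain ⟨h0, l, hl⟩ := mem_poles.1 h1
    by_contra! hle
    refine hadm l _ (norm_pos_iff.2 h0) ?_ hl
    rw [norm_mul, norm_inv, hnα, inv_mul_le_iff₀ hρ]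
    exact hle
  rw [hankel_eq_tiltedHankel (f := fun u => F u δ) hρ hr'
      (fun u => by rw [F_G, ← hαφ]) z,
    tiltedHankel_radius hδ.1 (hreg φ ⟨hle, le_rfl⟩) (mul_pos hρ hr') hr hp' hp z,
    tiltedHankel_angle hδ hle hφ₀ hφπ hreg hr hp hz]

/-- For small `ω < 0` the angle `arg α + ω` stays in the regular window and below `π`. All contours
move to `φ₀`, and `ω` survives only in the exponential factor, which tends to `α^{-s}`. -/
theorem L_G_eval {φ₀ r : ℝ} (hφ₀ : -Real.pi < φ₀) (hlt : φ₀ < α.arg)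
    (hreg : ∀ t ∈ Set.Ico φ₀ α.arg, IsRegularAngle δ t) (hr : 0 < r)
    (hp : ∀ u ∈ poles δ, r < ‖u‖) {s : ℂ} (hs : s.re < 1) :
    LDefined ε s (G Λ σ α δ) ∧ L ε s (G Λ σ α δ) =
      (-1) ^ Λ.card * e ((∑ l ∈ Λ.image (fun j => σ⁻¹ j), δ.2.2 l : ℝ) : ℂ) * α ^ (-s) *
        (gammaFactor s * tiltedHankel (fun u => F u δ) r φ₀ s) := by
  set c : ℂ := (-1) ^ Λ.card * e ((∑ l ∈ Λ.image (fun j => σ⁻¹ j), δ.2.2 l : ℝ) : ℂ)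
  set H := tiltedHankel (fun u => F u δ) r φ₀ with hHdef
  have hρ : 0 < ‖α‖ := norm_pos_iff.2 hα
  have hHd : Differentiable ℂ H :=
    differentiable_tiltedHankel hδ.1 (hreg _ ⟨le_rfl, hlt⟩) hr hp
  have hω : ∀ᶠ ω : ℝ in 𝓝[<] 0, ω ∈ Set.Ioo (φ₀ - α.arg) 0 :=
    Ioo_mem_nhdsLT (by linarith)
  have hpolar : ∀ ω : ℝ, Complex.exp (Complex.I * ω) * α =
      ‖α‖ * Complex.exp (Complex.I * (α.arg + ω : ℝ)) := by
    intro ω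
    conv_lhs => rw [← Complex.norm_mul_exp_arg_mul_I α]
    push_cast
    rw [mul_add, Complex.exp_add, mul_comm (α.arg : ℂ)]
    ring
  have hne : ∀ ω : ℝ, Complex.exp (Complex.I * ω) * α ≠ 0 := fun ω =>
    mul_ne_zero (Complex.exp_ne_zero _) hα
  have hlim : ∀ ω ∈ Set.Ioo (φ₀ - α.arg) 0,
      Tendsto (fun z => Lraw ε z (M (Complex.exp (Complex.I * ω)) (G Λ σ α δ))) (𝓝[≠] s)
        (𝓝 (gammaFactor s * (c * Complex.exp (-s * (Real.log ‖α‖ + Complex.I * (α.arg + ω : ℝ))) *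
          H s))) := by
    intro ω hω
    rw [M_G]
    refine tendsto_Lraw (H := fun z => c *
      Complex.exp (-z * (Real.log ‖α‖ + Complex.I * (α.arg + ω : ℝ))) * H z) hs ?_ fun z hz => ?_
    · exact ContinuousAt.mul (by fun_prop) (hHd s).continuousAt
    · exact hankel_G hε hδ Λ σ (hne ω) hφ₀ (by linarith [hω.1])
        (by linarith [hω.2, Complex.arg_le_pi α])
        (fun t ht => hreg t ⟨ht.1, by linarith [ht.2, hω.2]⟩) hr hp hρ (hpolar ω) hz
  have hL : Tendsto (fun ω : ℝ => Leps ε s (M (Complex.exp (Complex.I * ω)) (G Λ σ α δ)))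
      (𝓝[<] 0) (𝓝 (c * α ^ (-s) * (gammaFactor s * H s))) := by
    have hcont : Continuous fun ω : ℝ => gammaFactor s *
        (c * Complex.exp (-s * (Real.log ‖α‖ + Complex.I * (α.arg + ω : ℝ))) * H s) := by fun_prop
    have h0 := (hcont.tendsto 0).mono_left (nhdsWithin_le_nhds (s := Set.Iio 0))
    have hval : gammaFactor s *
        (c * Complex.exp (-s * (Real.log ‖α‖ + Complex.I * (α.arg + (0 : ℝ) : ℝ))) * H s) =
        c * α ^ (-s) * (gammaFactor s * H s) := by
      rw [add_zero, Complex.cpow_def_of_ne_zero hα, Complex.log, mul_comm (α.arg : ℂ),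
        mul_comm (_ + _) (-s)]
      ring
    rw [hval] at h0
    refine h0.congr' ?_
    filter_upwards [hω] with ω hω'
    exact (hlim ω hω').limUnder_eq.symm
  refine ⟨⟨?_, _, hL⟩, hL.limUnder_eq⟩
  filter_upwards [hω] with ω hω'
  refine ⟨fun z => ?_, _, hlim ω hω'⟩
  rw [M_G]
  exact integrableOn_G hε hδ Λ σ (hne ω)
    (hreg _ ⟨by linarith [hω'.1], by linarith [hω'.2]⟩) hρ (hpolar ω) z

end Eval

/-! ### The residue sum of a sector -/

lemma exists_regular_left {N : ℕ} {δ : Param N} (hδ : δ ∈ starD N) (t₀ : ℝ) :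
    ∃ η > 0, ∀ t ∈ Set.Ico (t₀ - η) t₀, IsRegularAngle δ t := by
  have h := (eventually_isRegularAngle hδ t₀).filter_mono
    (nhdsWithin_mono t₀ (fun t (ht : t < t₀) => ht.ne))
  obtain ⟨a, ha, h'⟩ := mem_nhdsLT_iff_exists_Ico_subset.1 h
  exact ⟨t₀ - a, sub_pos.2 ha, fun t ht => h' ⟨by linarith [ht.1], ht.2⟩⟩

lemma polar_mem_poles_not_regular {N : ℕ} {δ : Param N} (hδ : δ ∈ bigD N) {u : ℂ}
    (hu : u ∈ poles δ) : ¬IsRegularAngle δ u.arg := fun h =>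
  notMem_poles_of_isRegularAngle hδ h ‖u‖ (by
    rwa [mul_comm Complex.I, Complex.norm_mul_exp_arg_mul_I])

/-- Since the windows of width `η` to the left of `0` and `ψ` contain no arguments of poles, turning
both boundary rays clockwise by `η` selects the same poles. The half-open sector thus becomes an
open one with regular sides. For `ψ < 0` the two rays change order, which accounts for the sign. -/
theorem tendsto_residueSum {N : ℕ} {δ : Param N} (hδ : δ ∈ starD N) {ψ η r : ℝ} (hη : 0 < η)
    (hηπ : η < Real.pi) (hψ : -Real.pi < ψ - η) (hψπ : ψ ≤ Real.pi)
    (h0 : ∀ t ∈ Set.Ico (-η) 0, IsRegularAngle δ t)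
    (hψη : ∀ t ∈ Set.Ico (ψ - η) ψ, IsRegularAngle δ t)
    (hr : 0 < r) (hp : ∀ u ∈ poles δ, r < ‖u‖) {s : ℂ} (hs : s.re < 1) :
    ∃ c, Tendsto (residueSum ψ s δ) (farRadii δ) (𝓝 c) ∧
      (Real.sign (-ψ) : ℂ) * (2 * Real.pi * Complex.I) * c =
        ray (fun u => F u δ) r (ψ - η) s + arc (fun u => F u δ) r (-η) (ψ - η) s -
          ray (fun u => F u δ) r (-η) s := by
  have r0 := h0 (-η) ⟨le_rfl, by linarith⟩
  have r1 := hψη (ψ - η) ⟨le_rfl, by linarith⟩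
  have hnot : ∀ u ∈ poles δ, u.arg ∉ Set.Ico (-η) 0 ∧ u.arg ∉ Set.Ico (ψ - η) ψ := fun u hu =>
    ⟨fun h => polar_mem_poles_not_regular hδ.1 hu (h0 _ h),
      fun h => polar_mem_poles_not_regular hδ.1 hu (hψη _ h)⟩
  rcases lt_trichotomy ψ 0 with hneg | rfl | hpos
  · have hset : ∀ R, {u | u ∈ sectorPoles ψ δ ∧ ‖u‖ < R} =
        {u | u ∈ poles δ ∧ ψ - η < u.arg ∧ u.arg < -η ∧ ‖u‖ < R} := by
      intro R
      ext u
      simp only [sectorPoles, Set.mem_ofPred_eq]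
      constructor
      · rintro ⟨⟨hu, h | h⟩, hR⟩
        · linarith
        · have := hnot u hu
          simp only [Set.mem_Ico, not_and, not_lt] at this
          refine ⟨hu, by linarith, ?_, hR⟩
          by_contra! h'
          linarith [this.1 h']
      · rintro ⟨hu, h1, h2, hR⟩
        have := hnot u hu
        simp only [Set.mem_Ico, not_and, not_lt] at this
        exact ⟨⟨hu, Or.inr ⟨hneg, this.2 h1.le, by linarith⟩⟩, hR⟩
    have hlim := tendsto_residue_sum hδ (show ψ - η ≤ -η by linarith) hψ (by linarith) r1 r0 hr hp hs
    refine ⟨_, hlim.congr fun R => ?_, ?_⟩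
    · rw [residueSum, hset]
    · rw [Real.sign_of_pos (by linarith), Complex.ofReal_one, one_mul,
        mul_inv_cancel_left₀ two_pi_I_ne_zero]
      simp only [arc]
      rw [intervalIntegral.integral_symm]
      ring
  · refine ⟨0, tendsto_const_nhds.congr fun R => ?_, ?_⟩
    · simp [residueSum, sectorPoles]
    · simp [arc]
  · have hset : ∀ R, {u | u ∈ sectorPoles ψ δ ∧ ‖u‖ < R} =
        {u | u ∈ poles δ ∧ -η < u.arg ∧ u.arg < ψ - η ∧ ‖u‖ < R} := by
      intro R
      ext u
      simp only [sectorPoles, Set.mem_ofPred_eq]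
      constructor
      · rintro ⟨⟨hu, h | h⟩, hR⟩
        · have := hnot u hu
          simp only [Set.mem_Ico, not_and, not_lt] at this
          refine ⟨hu, by linarith, ?_, hR⟩
          by_contra! h'
          linarith [this.2 h']
        · linarith
      · rintro ⟨hu, h1, h2, hR⟩
        have := hnot u hu
        simp only [Set.mem_Ico, not_and, not_lt] at this
        exact ⟨⟨hu, Or.inl ⟨hpos, this.1 h1.le, by linarith⟩⟩, hR⟩
    have hlim := tendsto_residue_sum hδ (show -η ≤ ψ - η by linarith) (by linarith) (by linarith)
      r0 r1 hr hp hs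
    refine ⟨_, hlim.congr fun R => ?_, ?_⟩
    · rw [residueSum, hset]
    · rw [Real.sign_of_neg (by linarith), Complex.ofReal_neg, Complex.ofReal_one, mul_assoc,
        mul_inv_cancel_left₀ two_pi_I_ne_zero]
      ring

end Barnes

/-! ### The transformation of values and derivatives at `s = -k` -/

theorem corollary1 (N : ℕ) (hN : 1 ≤ N)
    (ε : Barnes.Param N → ℝ) (hε : ε ∈ Barnes.admissible N)
    (Λ : Finset (Fin N)) (σ : Equiv.Perm (Fin N)) (α : ℂ) (hα : α ≠ 0)
    (k : ℕ) (w : ℂ) (a : Fin N → ℂ) (θ : Fin N → ℝ) (hδ : (w, a, θ) ∈ Barnes.starD N) :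
    -- all objects in the two formulas are well-defined
    Barnes.G Λ σ α (w, a, θ) ∈ Barnes.starD N ∧
    (∀ᶠ s in 𝓝 (-(k : ℂ)), Barnes.LDefined ε s (w, a, θ)) ∧
    (∀ᶠ s in 𝓝 (-(k : ℂ)), Barnes.LDefined ε s (Barnes.G Λ σ α (w, a, θ))) ∧
    DifferentiableAt ℂ (fun s => Barnes.L ε s (w, a, θ)) (-(k : ℂ)) ∧
    DifferentiableAt ℂ (fun s => Barnes.L ε s (Barnes.G Λ σ α (w, a, θ))) (-(k : ℂ)) ∧
    Barnes.RhoDefined α.arg (-(k : ℂ)) (w, a, θ) ∧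
    -- the values
    Barnes.L ε (-(k : ℂ)) (Barnes.G Λ σ α (w, a, θ)) =
      Barnes.J Λ σ α (-(k : ℂ)) θ * Barnes.L ε (-(k : ℂ)) (w, a, θ) ∧
    -- the derivatives
    deriv (fun s => Barnes.L ε s (Barnes.G Λ σ α (w, a, θ))) (-(k : ℂ)) =
      Barnes.J Λ σ α (-(k : ℂ)) θ *
        (deriv (fun s => Barnes.L ε s (w, a, θ)) (-(k : ℂ))
          - Complex.log α * Barnes.L ε (-(k : ℂ)) (w, a, θ)
          + (-1) ^ k * (k.factorial : ℂ) * Barnes.rho α.arg (-(k : ℂ)) (w, a, θ)) := by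
  open Barnes in
  set δ : Param N := (w, a, θ)
  set s₀ : ℂ := -(k : ℂ) with hs₀
  set ψ := α.arg
  have hs₀re : s₀.re < 1 := by
    simp only [hs₀, Complex.neg_re, Complex.natCast_re]
    linarith [(Nat.cast_nonneg k : (0 : ℝ) ≤ k)]
  have hev : ∀ᶠ s : ℂ in 𝓝 s₀, s.re < 1 :=
    Complex.continuous_re.continuousAt.eventually_lt_const hs₀re
  obtain ⟨r, hr, hp⟩ := exists_radius hε hδ
  obtain ⟨η₁, hη₁, hreg₁⟩ := exists_regular_left hδ 0
  obtain ⟨η₂, hη₂, hreg₂⟩ := exists_regular_left hδ ψ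
  -- The bounds `η₁`, `η₂` keep both windows regular; `π` and `ψ + π` keep the angles `-η` and `ψ -
  -- η` above `-π`, within the principal branch.
  obtain ⟨η, hη, hlt⟩ : ∃ η > 0, η < min (min η₁ η₂) (min Real.pi (ψ + Real.pi)) :=
    exists_between (lt_min (lt_min hη₁ hη₂)
      (lt_min Real.pi_pos (by linarith [Complex.neg_pi_lt_arg α])))
  simp only [lt_min_iff] at hlt
  obtain ⟨⟨hlt1, hlt2⟩, hlt3, hlt4⟩ := hlt
  have hR₁ : ∀ t ∈ Set.Ico (-η) 0, IsRegularAngle δ t := fun t ht =>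
    hreg₁ t ⟨by linarith [ht.1], ht.2⟩
  have hR₂ : ∀ t ∈ Set.Ico (ψ - η) ψ, IsRegularAngle δ t := fun t ht =>
    hreg₂ t ⟨by linarith [ht.1], ht.2⟩
  set H₁ := tiltedHankel (fun u => F u δ) r (-η)
  set H₂ := tiltedHankel (fun u => F u δ) r (ψ - η)
  set C : ℂ := (-1) ^ Λ.card * e ((∑ l ∈ Λ.image (fun j => σ⁻¹ j), θ l : ℝ) : ℂ)
  -- The point `δ` itself is the case of the identity transformation, with `arg 1 = 0`.
  have E₁ : ∀ s : ℂ, s.re < 1 → LDefined ε s δ ∧ L ε s δ = gammaFactor s * H₁ s := by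
    intro s hs
    have := L_G_eval hε hδ ∅ 1 one_ne_zero (φ₀ := -η) (by linarith)
      (by rw [Complex.arg_one]; linarith) (by rwa [Complex.arg_one]) hr hp hs
    simpa [G_one, e] using this
  have E₂ : ∀ s : ℂ, s.re < 1 → LDefined ε s (G Λ σ α δ) ∧
      L ε s (G Λ σ α δ) = C * α ^ (-s) * (gammaFactor s * H₂ s) := fun s hs =>
    L_G_eval hε hδ Λ σ hα (by linarith) (by linarith) hR₂ hr hp hs
  have hreg₁0 := hR₁ (-η) ⟨le_rfl, by linarith⟩
  have hreg₂0 := hR₂ (ψ - η) ⟨le_rfl, by linarith⟩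
  have hcirc : ∀ t : ℝ, ContinuousAt (fun u => F u δ) (r * Complex.exp (Complex.I * t)) :=
    fun t => (differentiableAt_F_circle hr (fun u hu => (hp u hu).ne') t).continuousAt
  set K : ℂ → ℂ := fun s => ray (fun u => F u δ) r (ψ - η) s +
    arc (fun u => F u δ) r (-η) (ψ - η) s - ray (fun u => F u δ) r (-η) s with hK
  have hKd : Differentiable ℂ K :=
    ((ray_convergence hδ.1 hreg₂0 hr).2.add (differentiable_arc hcirc _ _)).sub
      (ray_convergence hδ.1 hreg₁0 hr).2
  have hH : ∀ s, H₂ s = H₁ s + (e s - 1) * K s := fun s => by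
    have := tiltedHankel_sub hcirc (-η) (ψ - η) s
    linear_combination this
  have hH₁d : DifferentiableAt ℂ H₁ s₀ := differentiable_tiltedHankel hδ.1 hreg₁0 hr hp s₀
  have hg : DifferentiableAt ℂ gammaFactor s₀ := differentiableAt_gammaFactor hs₀re
  have heq₁ : (fun s => L ε s δ) =ᶠ[𝓝 s₀] fun s => gammaFactor s * H₁ s :=
    hev.mono fun s hs => (E₁ s hs).2
  have hD₁ : DifferentiableAt ℂ (fun s => L ε s δ) s₀ :=
    (hg.mul hH₁d).congr_of_eventuallyEq heq₁
  have heq₂ : (fun s => L ε s (G Λ σ α δ)) =ᶠ[𝓝 s₀]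
      fun s => C * (α ^ (-s) * (L ε s δ + gammaFactor s * ((e s - 1) * K s))) := by
    filter_upwards [hev] with s hs
    rw [(E₂ s hs).2, (E₁ s hs).2, hH]
    ring
  have he₀ : e s₀ = 1 := e_neg_nat k
  have hpow : HasDerivAt (fun s : ℂ => α ^ (-s)) (α ^ (-s₀) * Complex.log α * -1) s₀ :=
    (hasDerivAt_neg s₀).const_cpow (Or.inl hα)
  -- As `e(s) - 1` vanishes at `s₀`, the derivatives of `gammaFactor` and `K` drop out and only the
  -- derivative of `e` contributes.
  have hfac : HasDerivAt (fun s => gammaFactor s * ((e s - 1) * K s))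
      (gammaFactor s₀ * (2 * Real.pi * Complex.I) * K s₀) s₀ := by
    have := hg.hasDerivAt.mul (((hasDerivAt_e s₀).sub_const 1).mul (hKd s₀).hasDerivAt)
    refine this.congr_deriv ?_
    simp only [Pi.mul_apply, he₀]
    ring
  have hmain := ((hpow.mul (hD₁.hasDerivAt.add hfac)).const_mul C).congr_of_eventuallyEq heq₂
  obtain ⟨ρ, hρ, hρK⟩ := tendsto_residueSum hδ hη hlt3 (by linarith) (Complex.arg_le_pi α) hR₁ hR₂
    hr hp hs₀re
  have hneBot := farRadii_neBot hδ.1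
  have hrho : rho ψ s₀ δ = K s₀ := by
    rw [rho, hρ.limUnder_eq, hρK]
  refine ⟨G_mem_starD Λ σ hα hδ, hev.mono fun s hs => (E₁ s hs).1,
    hev.mono fun s hs => (E₂ s hs).1, hD₁, hmain.differentiableAt, ⟨hneBot, ρ, hρ⟩, ?_, ?_⟩
  · rw [(E₂ s₀ hs₀re).2, (E₁ s₀ hs₀re).2, hH, he₀, J]
    simp only [C]
    ring
  · rw [hmain.deriv, hrho, ← gammaFactor_neg_nat, J]
    simp only [Pi.add_apply, he₀, C]
    ring
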